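/- Let $p\in(1,\infty)$ with $p\neq 2$, let $\mathbb{B}^n$ be the open unit ball of $\mathbb{R}^n$, and put $$\bar q_1:=\sup_{b\in(0,\infty)}\Big(\frac{p-1}{b^{p-1}+1}+\frac{b}{b+1}\Big).$$ For a function $v$ on $\mathbb{B}^2$ write $\nabla^\perp v=(-\partial_2 v,\partial_1 v)$. A Lipschitz function on $\mathbb{B}^2$ is called piecewise affine if there are at most countably many pairwise disjoint open subsets of $\mathbb{B}^2$ which cover $\mathbb{B}^2$ up to a null set and on each of which the function is affine. (i) We have $\bar q_1>\max\{p-1,1\}$. (ii) Let $\max\{p-1,1\}<\bar q<\bar q_1$. Then for every $\Lambda>0$ and every $r\in(\max\{p-1,1\},\bar q)$ there exist piecewise affine Lipschitz functions $u,v\in W^{1,p}_0(\mathbb{B}^2)$ such that $$\int_{\mathbb{B}^2}|\nabla u|^r>\Lambda\int_{\mathbb{B}^2}\big||\nabla u|^{p-2}\nabla u-\nabla^\perp v\big|^{\frac r{p-1}}.$$ Moreover, $u\in W^{1,r}_0(\mathbb{B}^2)$, and $f:=|\nabla u|^{p-2}\nabla u-\nabla^\perp v$ belongs to $L^{\frac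 r{p-1}}\cap L^{\frac p{p-1}}(\mathbb{B}^2,\mathbb{R}^2)$ and satisfies $\operatorname{div}(|\nabla u|^{p-2}\nabla u)=\operatorname{div} f$ in the sense of distributions in $\mathbb{B}^2$. (iii) Consequently, for every $r$ with $\max\{p-1,1\}<r<\bar q_1$ there is no constant $C$ such that $$\int_{\mathbb{B}^2}|\nabla u|^r\le C\int_{\mathbb{B}^2}|f|^{\frac r{p-1}}$$ for all $u\in W^{1,r}_0\cap W^{1,p}_0(\mathbb{B}^2)$ and $f\in L^{\frac r{p-1}}\cap L^{\frac p{p-1}}(\mathbb{B}^2,\mathbb{R}^2)$ with $\operatorname{div}(|\nabla u|^{p-2}\nabla u)=\operatorname{div} f$ in the sense of distributions in $\mathbb{B}^2$. In particular, Iwaniec's 1983 conjecture is false. It asserts that for all $n\ge 2$, $p>1$ and $r>\max\{p-1,1\}$ there is a constant $C_{r,p,n}$ such that $$\int_{\mathbb{B}^n}|\nabla u|^r\le C_{r,p,n}\int_{\mathbb{B}^n}|f|^{\frac r{p-1}}$$ for all $u\in W^{1,r}_0\cap W^{1,p}_0(\mathbb{B}^n)$ and $f\in L^{\frac r{p-1}}\cap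 L^{\frac p{p-1}}(\mathbb{B}^n,\mathbb{R}^n)$ with $\operatorname{div}(|\nabla u|^{p-2}\nabla u)=\operatorname{div} f$ in the sense of distributions in $\mathbb{B}^n$. -/

import Mathlib

open MeasureTheory Set Filter Topology
open scoped ContDiff

noncomputable section

/-- The Euclidean space `ℝⁿ`. -/
abbrev Eucl (n : ℕ) : Type := EuclideanSpace ℝ (Fin n)

/-- The open unit ball `𝔹ⁿ` of `ℝⁿ`. -/
def unitBall (n : ℕ) : Set (Eucl n) := Metric.ball 0 1

/-- Test functions on `Ω`: smooth functions with compact support contained in `Ω`. -/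
def IsTestFunction {n : ℕ} (Ω : Set (Eucl n)) (φ : Eucl n → ℝ) : Prop :=
  ContDiff ℝ ∞ φ ∧ HasCompactSupport φ ∧ tsupport φ ⊆ Ω

/-- `G` is the weak (distributional) gradient of `u` in `Ω`. -/
def HasWeakGradient {n : ℕ} (Ω : Set (Eucl n)) (u : Eucl n → ℝ) (G : Eucl n → Eucl n) : Prop :=
  ∀ φ : Eucl n → ℝ, IsTestFunction Ω φ →
    ∫ x in Ω, u x • gradient φ x = - ∫ x in Ω, φ x • G x

/-- `u ∈ W^{1,s}(Ω)` with weak gradient `G`. -/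
def MemSobolev {n : ℕ} (Ω : Set (Eucl n)) (s : ℝ) (u : Eucl n → ℝ) (G : Eucl n → Eucl n) : Prop :=
  MemLp u (ENNReal.ofReal s) (volume.restrict Ω) ∧
  MemLp G (ENNReal.ofReal s) (volume.restrict Ω) ∧
  HasWeakGradient Ω u G

/-- `u ∈ W^{1,s}_0(Ω)` with weak gradient `G`: the function `u` belongs to `W^{1,s}(Ω)`, and it is
the limit in `W^{1,s}(Ω)` of test functions on `Ω`. -/
def MemSobolevZero {n : ℕ} (Ω : Set (Eucl n)) (s : ℝ) (u : Eucl n → ℝ)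
    (G : Eucl n → Eucl n) : Prop :=
  MemSobolev Ω s u G ∧
  ∃ φ : ℕ → Eucl n → ℝ, (∀ k, IsTestFunction Ω (φ k)) ∧
    Tendsto (fun k => eLpNorm (fun x => φ k x - u x) (ENNReal.ofReal s) (volume.restrict Ω))
      atTop (𝓝 0) ∧
    Tendsto
      (fun k => eLpNorm (fun x => gradient (φ k) x - G x) (ENNReal.ofReal s) (volume.restrict Ω))
      atTop (𝓝 0)

/-- `u` is a piecewise affine Lipschitz function on `Ω`: it is Lipschitz on `Ω`, and there are at
most countably many pairwise disjoint open subsets of `Ω` which cover `Ω` up to a null set, such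
that `u` is affine on each of them (empty pieces are allowed, so that finite families are
included). -/
def IsPiecewiseAffineLipschitz {n : ℕ} (Ω : Set (Eucl n)) (u : Eucl n → ℝ) : Prop :=
  (∃ K : NNReal, LipschitzOnWith K u Ω) ∧
  ∃ U : ℕ → Set (Eucl n),
    (∀ i, IsOpen (U i)) ∧ (∀ i, U i ⊆ Ω) ∧ Pairwise (fun i j => Disjoint (U i) (U j)) ∧
    volume (Ω \ ⋃ i, U i) = 0 ∧
    ∀ i, ∃ (a : Eucl n) (c : ℝ), ∀ x ∈ U i, u x = inner ℝ a x + c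

/-- The nonlinearity `|ξ|^{p-2} ξ` of the `p`-Laplace operator (equal to `0` at `ξ = 0`). -/
def pFlux {n : ℕ} (p : ℝ) (ξ : Eucl n) : Eucl n := ‖ξ‖ ^ (p - 2) • ξ

/-- The rotated gradient `∇^⊥ v = (-∂₂ v, ∂₁ v)` in the plane. -/
def perpGradient (v : Eucl 2 → ℝ) (x : Eucl 2) : Eucl 2 :=
  !₂[-(gradient v x 1), gradient v x 0]

/-- The vector field `|∇u|^{p-2} ∇u - ∇^⊥ v` in the plane. -/
def fluxDefect (p : ℝ) (u v : Eucl 2 → ℝ) (x : Eucl 2) : Eucl 2 :=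
  pFlux p (gradient u x) - perpGradient v x

/-- `div (|G|^{p-2} G) = div f` in the sense of distributions in `Ω`. -/
def SolvesPLaplace {n : ℕ} (Ω : Set (Eucl n)) (p : ℝ) (G f : Eucl n → Eucl n) : Prop :=
  ∀ φ : Eucl n → ℝ, IsTestFunction Ω φ →
    ∫ x in Ω, inner ℝ (pFlux p (G x)) (gradient φ x) = ∫ x in Ω, inner ℝ (f x) (gradient φ x)

/-- The threshold `sup_{b > 0} ((p-1)/(b^{p-1}+1) + b/(b+1))`. -/
def thresholdExponent (p : ℝ) : ℝ :=
  sSup ((fun b : ℝ => (p - 1) / (b ^ (p - 1) + 1) + b / (b + 1)) '' Ioi 0)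

/-- Iwaniec's a priori estimate for the dimension `n` and the exponents `p` and `r`: there is one
constant `C` with `∫ |∇u|^r ≤ C ∫ |f|^{r/(p-1)}` for all `u ∈ W^{1,r}_0 ∩ W^{1,p}_0 (𝔹ⁿ)` (with weak
gradient `G`) and all `f ∈ L^{r/(p-1)} ∩ L^{p'} (𝔹ⁿ, ℝⁿ)`, `p' = p/(p-1)`, which solve
`div (|∇u|^{p-2} ∇u) = div f` in `𝔹ⁿ`. -/
def IwaniecEstimate (n : ℕ) (p r : ℝ) : Prop :=
  ∃ C : ℝ, ∀ (u : Eucl n → ℝ) (G f : Eucl n → Eucl n),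
    MemSobolevZero (unitBall n) r u G →
    MemSobolevZero (unitBall n) p u G →
    MemLp f (ENNReal.ofReal (r / (p - 1))) (volume.restrict (unitBall n)) →
    MemLp f (ENNReal.ofReal (p / (p - 1))) (volume.restrict (unitBall n)) →
    SolvesPLaplace (unitBall n) p G f →
    ∫ x in unitBall n, ‖G x‖ ^ r ≤ C * ∫ x in unitBall n, ‖f x‖ ^ (r / (p - 1))

/-- Iwaniec's conjecture: the estimate holds for all `n ≥ 2`, `p > 1` and `r > max {p-1, 1}`. -/
def IwaniecConjecture : Prop :=
  ∀ (n : ℕ) (p r : ℝ), 2 ≤ n → 1 < p → max (p - 1) 1 < r → IwaniecEstimate n p r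

end

/-! Let `F = Λ|pFlux(∇u) - ∇^⊥v|^{r/(p-1)} - |∇u|^r`, the `defectEnergy`. Everything reduces to
finding a compactly supported piecewise affine pair `(u, v)` in the disc with `∫ F < 0`, that is, to
the failure of quasiconvexity of `F` at the zero gradient.

The failure comes from a staircase laminate among the states `∇u = (x, 0)`, `∇^⊥v = (y, 0)`. Two
such states that share `y` or share `x` differ by a rank-one matrix, so both can be mixed. On the
odd curve `y = |x|^{p-2}x` the defect vanishes and the energy is `-|x|^r`. Take `β = b^{p-1}`. The
state `(x, -βx^{p-1})` is a horizontal mixture of `(-bx, -βx^{p-1})`, which lies on the curve, and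
`(θx, -βx^{p-1})`; the latter is a vertical mixture of `(θx, (θx)^{p-1})`, again on the curve, and
`(θx, -β(θx)^{p-1})`, which is the initial state with `x` enlarged by `θ > 1`. If the initial states
cost at most `τx^r`, one round improves this to `(μτ - c)x^r` with `c > 0`, where `μ` is the weight
of the remaining state times `θ^r`. The logarithmic derivative of `μ` at `θ = 1` is `r - 1/(1+b) -
(p-1)β/(1+β)`, which is negative for a suitable `b` exactly when `r` is below the threshold. Then `μ
< 1` for some `θ`, and finitely many rounds make the cost negative (`staircase_step`, `staircase`).
Two more mixtures lead back to the origin.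

`Relaxes` turns laminates into functions without tracking measures: `Relaxes.rankOne` says that
attainable energies may be averaged along rank-one segments, and `Relaxes.exists_on_open` moves a
construction to any bounded open set by a Vitali covering. Each step uses finitely many pieces, so
the maps stay Lipschitz and locally affine almost everywhere; this gives piecewise affinity and
membership in the Sobolev spaces. Since `∇^⊥v` is divergence free, the defect is an admissible
right-hand side `f`, and letting `Λ` be the alleged constant refutes the estimate. -/

/-! ### Maps that are affine near a point. -/

section LocallyAffine

variable {E V W : Type*} [NormedAddCommGroup E] [NormedSpace ℝ E]
  [NormedAddCommGroup V] [NormedSpace ℝ V] [NormedAddCommGroup W] [NormedSpace ℝ W]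

/-- `w` coincides with an affine function near `x`. -/
def LocallyAffineAt (w : E → V) (x : E) : Prop :=
  ∃ L : E →L[ℝ] V, ∀ᶠ y in 𝓝 x, w y = w x + L (y - x)

theorem LocallyAffineAt.hasFDerivAt {w : E → V} {x : E} {L : E →L[ℝ] V}
    (h : ∀ᶠ y in 𝓝 x, w y = w x + L (y - x)) : HasFDerivAt w L x := by
  have h1 : HasFDerivAt (fun y => w x + L (y - x)) L x :=
    (L.hasFDerivAt.comp x ((hasFDerivAt_id x).sub_const x)).const_add (w x)
  exact h1.congr_of_eventuallyEq h

theorem LocallyAffineAt.differentiableAt {w : E → V} {x : E} (h : LocallyAffineAt w x) :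
    DifferentiableAt ℝ w x := by
  obtain ⟨L, hL⟩ := h
  exact (LocallyAffineAt.hasFDerivAt hL).differentiableAt

theorem LocallyAffineAt.eventually_eq {w : E → V} {x : E} (h : LocallyAffineAt w x) :
    ∀ᶠ y in 𝓝 x, w y = w x + fderiv ℝ w x (y - x) := by
  obtain ⟨L, hL⟩ := h
  rwa [(LocallyAffineAt.hasFDerivAt hL).fderiv]

theorem LocallyAffineAt.of_eventually_eq {w : E → V} {x : E} {L : E →L[ℝ] V} {c : V}
    (h : ∀ᶠ y in 𝓝 x, w y = L y + c) : LocallyAffineAt w x := by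
  refine ⟨L, ?_⟩
  have hx := h.self_of_nhds
  filter_upwards [h] with y hy
  rw [hy, hx, map_sub]; abel

theorem LocallyAffineAt.congr {w w' : E → V} {x : E} (h : LocallyAffineAt w x)
    (h' : w' =ᶠ[𝓝 x] w) : LocallyAffineAt w' x := by
  obtain ⟨L, hL⟩ := h
  refine ⟨L, ?_⟩
  have hx := h'.self_of_nhds
  filter_upwards [hL, h'] with y hy hy'
  rw [hy', hy, hx]

theorem LocallyAffineAt.add {w w' : E → V} {x : E} (h : LocallyAffineAt w x)
    (h' : LocallyAffineAt w' x) : LocallyAffineAt (fun y => w y + w' y) x := by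
  obtain ⟨L, hL⟩ := h
  obtain ⟨L', hL'⟩ := h'
  refine ⟨L + L', ?_⟩
  filter_upwards [hL, hL'] with y hy hy'
  rw [hy, hy', add_apply]; abel

theorem LocallyAffineAt.clm_comp {w : E → V} {x : E} (h : LocallyAffineAt w x)
    (T : V →L[ℝ] W) : LocallyAffineAt (fun y => T (w y)) x := by
  obtain ⟨L, hL⟩ := h
  refine ⟨T.comp L, ?_⟩
  filter_upwards [hL] with y hy
  rw [hy, map_add, ContinuousLinearMap.comp_apply]

theorem LocallyAffineAt.comp_smul_sub {w : E → V} {x c : E} {a : ℝ}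
    (h : LocallyAffineAt w (a • (x - c))) : LocallyAffineAt (fun y => w (a • (y - c))) x := by
  obtain ⟨L, hL⟩ := h
  refine ⟨a • L, ?_⟩
  have hc : Tendsto (fun y => a • (y - c)) (𝓝 x) (𝓝 (a • (x - c))) :=
    Continuous.tendsto (by fun_prop) x
  filter_upwards [hc.eventually hL] with y hy
  rw [hy, ← smul_sub, smul_apply, map_smul]
  congr 3; abel

theorem isOpen_setOf_locallyAffineAt (w : E → V) : IsOpen {x | LocallyAffineAt w x} := by
  rw [isOpen_iff_mem_nhds]
  rintro x ⟨L, hL⟩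
  filter_upwards [hL.eventually_nhds] with y hy
  refine LocallyAffineAt.of_eventually_eq (L := L) (c := w x - L x) ?_
  filter_upwards [hy] with z hz
  rw [hz, map_sub]; abel

end LocallyAffine

/-! ### Compactly supported piecewise affine perturbations and their energy excess. -/

section Perturbation

theorem tsupport_sum_subset {n : ℕ} {V ι : Type*} [NormedAddCommGroup V]
    (s : Finset ι) (w : ι → Eucl n → V) :
    tsupport (fun y => ∑ i ∈ s, w i y) ⊆ ⋃ i ∈ s, tsupport (w i) := by
  refine closure_minimal (fun x hx => ?_)
    (isClosed_biUnion_finset fun i _ => isClosed_tsupport (w i))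
  by_contra h
  simp only [mem_iUnion, not_exists] at h
  exact hx (Finset.sum_eq_zero fun i hi => image_eq_zero_of_notMem_tsupport (h i hi))

variable {n : ℕ} {V W : Type*} [NormedAddCommGroup V] [NormedSpace ℝ V]
  [NormedAddCommGroup W] [NormedSpace ℝ W]

/-- Compactly supported Lipschitz maps which are locally affine almost everywhere. -/
structure IsPerturbation (w : Eucl n → V) : Prop where
  lipschitz : ∃ K, LipschitzWith K w
  compact : HasCompactSupport w
  affine : ∀ᵐ x, LocallyAffineAt w x

theorem IsPerturbation.zero : IsPerturbation (fun _ : Eucl n => (0 : V)) where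
  lipschitz := ⟨0, LipschitzWith.const 0⟩
  compact := HasCompactSupport.zero
  affine := Eventually.of_forall fun x => ⟨0, Eventually.of_forall fun y => by simp⟩

theorem IsPerturbation.add {w w' : Eucl n → V} (h : IsPerturbation w) (h' : IsPerturbation w') :
    IsPerturbation (fun x => w x + w' x) where
  lipschitz := by
    obtain ⟨K, hK⟩ := h.lipschitz
    obtain ⟨K', hK'⟩ := h'.lipschitz
    exact ⟨K + K', hK.add hK'⟩
  compact := h.compact.add h'.compact
  affine := by
    filter_upwards [h.affine, h'.affine] with x hx hx' using hx.add hx'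

theorem IsPerturbation.sum {ι : Type*} (s : Finset ι) {w : ι → Eucl n → V}
    (h : ∀ i ∈ s, IsPerturbation (w i)) : IsPerturbation (fun x => ∑ i ∈ s, w i x) := by
  classical
  induction s using Finset.induction_on with
  | empty => simpa using IsPerturbation.zero
  | insert a s ha ih =>
    simp only [Finset.sum_insert ha]
    exact (h a (Finset.mem_insert_self a s)).add
      (ih fun i hi => h i (Finset.mem_insert_of_mem hi))

theorem IsPerturbation.clm_comp {w : Eucl n → V} (h : IsPerturbation w) (T : V →L[ℝ] W) :
    IsPerturbation (fun x => T (w x)) where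
  lipschitz := by
    obtain ⟨K, hK⟩ := h.lipschitz
    exact ⟨_, T.lipschitz.comp hK⟩
  compact := h.compact.comp_left (map_zero T)
  affine := h.affine.mono fun x hx => hx.clm_comp T

theorem tendsto_rescale_ae (c : Eucl n) {ρ : ℝ} (hρ : 0 < ρ) :
    Tendsto (fun y : Eucl n => ρ⁻¹ • (y - c)) (ae volume) (ae volume) := by
  have h1 : Measure.QuasiMeasurePreserving (fun y : Eucl n => y - c) volume volume :=
    (measurePreserving_sub_right volume c).quasiMeasurePreserving
  have h2 : Tendsto (fun y : Eucl n => ρ⁻¹ • y) (ae volume) (ae volume) := by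
    intro s hs
    rw [mem_map, mem_ae_iff]
    rw [mem_ae_iff] at hs
    rw [← preimage_compl, Measure.addHaar_preimage_smul _ (inv_ne_zero hρ.ne'), hs, mul_zero]
  exact h2.comp h1.tendsto_ae

theorem IsPerturbation.rescale {w : Eucl n → V} (h : IsPerturbation w) (c : Eucl n) {ρ : ℝ}
    (hρ : 0 < ρ) : IsPerturbation (fun y => ρ • w (ρ⁻¹ • (y - c))) where
  lipschitz := by
    obtain ⟨K, hK⟩ := h.lipschitz
    refine ⟨K, LipschitzWith.of_dist_le_mul fun x y => ?_⟩
    rw [dist_smul₀, Real.norm_of_nonneg hρ.le]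
    calc ρ * dist (w (ρ⁻¹ • (x - c))) (w (ρ⁻¹ • (y - c)))
        ≤ ρ * (K * dist (ρ⁻¹ • (x - c)) (ρ⁻¹ • (y - c))) := by
          gcongr; exact hK.dist_le_mul _ _
      _ = K * dist x y := by
          rw [dist_smul₀, dist_sub_right, norm_inv, Real.norm_of_nonneg hρ.le]
          field_simp
  compact := by
    have h1 : HasCompactSupport (fun y => w (ρ⁻¹ • (y - c))) := by
      have := h.compact.comp_homeomorph
        ((Homeomorph.subRight c).trans (Homeomorph.smulOfNeZero ρ⁻¹ (inv_ne_zero hρ.ne')))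
      exact this
    exact h1.smul_left (f := fun _ => ρ)
  affine := by
    filter_upwards [(tendsto_rescale_ae c hρ).eventually h.affine] with x hx
    exact hx.comp_smul_sub.clm_comp (ρ • ContinuousLinearMap.id ℝ V)

theorem fderiv_rescale (w : Eucl n → V) (c : Eucl n) {ρ : ℝ} (hρ : 0 < ρ) (y : Eucl n) :
    fderiv ℝ (fun y => ρ • w (ρ⁻¹ • (y - c))) y = fderiv ℝ w (ρ⁻¹ • (y - c)) := by
  have h1 : (fun y => ρ • w (ρ⁻¹ • (y - c))) = ρ • (fun y => (fun z => w (ρ⁻¹ • z)) (y - c)) := rfl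
  rw [h1, fderiv_const_smul_field, Pi.smul_apply, fderiv_comp_sub (f := fun z => w (ρ⁻¹ • z)),
    fderiv_comp_smul, smul_smul, mul_inv_cancel₀ hρ.ne', one_smul]

theorem fderiv_eq_zero_of_notMem_tsupport {w : Eucl n → V} {x : Eucl n} (hx : x ∉ tsupport w) :
    fderiv ℝ w x = 0 := by
  by_contra h
  exact hx (support_fderiv_subset ℝ h)

/-- The increase of the energy `∫ F(A + Dw)` compared with the affine state `A`. -/
noncomputable def excess (F : (Eucl n →L[ℝ] V) → ℝ) (A : Eucl n →L[ℝ] V) (w : Eucl n → V) : ℝ :=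
  ∫ x, (F (A + fderiv ℝ w x) - F A)

/-- The rescaling keeps the values of the gradient and only shrinks the domain, so the excess scales
like volume. -/
theorem excess_rescale (F : (Eucl n →L[ℝ] V) → ℝ) (A : Eucl n →L[ℝ] V) (w : Eucl n → V)
    (c : Eucl n) {ρ : ℝ} (hρ : 0 < ρ) :
    excess F A (fun y => ρ • w (ρ⁻¹ • (y - c))) = ρ ^ n * excess F A w := by
  unfold excess
  simp only [fderiv_rescale w c hρ]
  rw [integral_sub_right_eq_self (fun y => F (A + fderiv ℝ w (ρ⁻¹ • y)) - F A) c,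
    Measure.integral_comp_inv_smul volume (fun y => F (A + fderiv ℝ w y) - F A) ρ]
  simp [abs_of_pos hρ]

theorem fderiv_sum_perturbation {ι : Type*} (s : Finset ι) {w : ι → Eucl n → V} {x : Eucl n}
    (hd : Pairwise fun i j => i ∈ s → j ∈ s → Disjoint (tsupport (w i)) (tsupport (w j)))
    {i : ι} (hi : i ∈ s) (hx : x ∈ tsupport (w i)) :
    fderiv ℝ (fun y => ∑ i ∈ s, w i y) x = fderiv ℝ (w i) x := by
  apply Filter.EventuallyEq.fderiv_eq
  have h : ∀ j ∈ s, j ≠ i → ∀ᶠ y in 𝓝 x, w j y = 0 := by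
    intro j hj hji
    have : x ∉ tsupport (w j) := fun h => (hd hji hj hi).le_bot ⟨h, hx⟩
    exact notMem_tsupport_iff_eventuallyEq.1 this
  have h' : ∀ᶠ y in 𝓝 x, ∀ j ∈ s, j ≠ i → w j y = 0 := by
    rw [eventually_all_finset]
    intro j hj
    by_cases hji : j = i
    · exact Eventually.of_forall fun y hy => absurd hji hy
    · exact (h j hj hji).mono fun y hy _ => hy
  filter_upwards [h'] with y hy
  exact Finset.sum_eq_single_of_mem i hi fun j hj hji => hy j hj hji

variable [FiniteDimensional ℝ V]

/-- Compactness in finite dimension. The uniformity in `A'` is what the dominated convergence in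
`continuous_excess` needs; for integrability `R = 0` suffices. -/
theorem exists_bound_comp_fderiv {F : (Eucl n →L[ℝ] V) → ℝ} (hF : Continuous F)
    (A : Eucl n →L[ℝ] V) (R K : ℝ) :
    ∃ M, ∀ A' L : Eucl n →L[ℝ] V, ‖A' - A‖ ≤ R → ‖L‖ ≤ K → ‖F (A' + L) - F A'‖ ≤ M := by
  have : ProperSpace (Eucl n →L[ℝ] V) := FiniteDimensional.proper ℝ _
  obtain ⟨M, hM⟩ := ((isCompact_closedBall A R).prod
    (isCompact_closedBall (0 : Eucl n →L[ℝ] V) K)).exists_bound_of_continuousOn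
    (f := fun q : (Eucl n →L[ℝ] V) × (Eucl n →L[ℝ] V) => F (q.1 + q.2) - F q.1)
    (Continuous.continuousOn (by fun_prop))
  refine ⟨M, fun A' L hA hL => hM (A', L) ⟨?_, ?_⟩⟩
  · simpa [dist_eq_norm] using hA
  · simpa using hL

theorem measurable_comp_fderiv {F : (Eucl n →L[ℝ] V) → ℝ} (hF : Continuous F)
    (A : Eucl n →L[ℝ] V) (w : Eucl n → V) :
    Measurable (fun x => F (A + fderiv ℝ w x) - F A) := by
  have : CompleteSpace V := FiniteDimensional.complete ℝ V
  borelize (Eucl n →L[ℝ] V)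
  have h1 : Measurable (fderiv ℝ w) := measurable_fderiv ℝ w
  have h2 : Continuous (fun L : Eucl n →L[ℝ] V => F (A + L) - F A) := by fun_prop
  exact h2.measurable.comp h1

theorem IsPerturbation.integrable {F : (Eucl n →L[ℝ] V) → ℝ} (hF : Continuous F)
    (A : Eucl n →L[ℝ] V) {w : Eucl n → V} (hw : IsPerturbation w) :
    Integrable (fun x => F (A + fderiv ℝ w x) - F A) := by
  obtain ⟨K, hK⟩ := hw.lipschitz
  obtain ⟨M, hM⟩ := exists_bound_comp_fderiv hF A 0 K
  have h1 : IntegrableOn (fun x => F (A + fderiv ℝ w x) - F A) (tsupport w) := by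
    refine IntegrableOn.of_bound hw.compact.isCompact.measure_lt_top
      (measurable_comp_fderiv hF A w).aestronglyMeasurable M (Eventually.of_forall fun x => ?_)
    exact hM A _ (by simp) (norm_fderiv_le_of_lipschitz ℝ hK)
  refine (integrableOn_iff_integrable_of_support_subset fun x hx => ?_).1 h1
  by_contra h
  exact hx (by simp [fderiv_eq_zero_of_notMem_tsupport h])

theorem excess_sum {F : (Eucl n →L[ℝ] V) → ℝ} (hF : Continuous F) (A : Eucl n →L[ℝ] V)
    {ι : Type*} (s : Finset ι) {w : ι → Eucl n → V} (hw : ∀ i ∈ s, IsPerturbation (w i))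
    (hd : Pairwise fun i j => i ∈ s → j ∈ s → Disjoint (tsupport (w i)) (tsupport (w j))) :
    excess F A (fun y => ∑ i ∈ s, w i y) = ∑ i ∈ s, excess F A (w i) := by
  unfold excess
  rw [← integral_finsetSum s fun i hi => (hw i hi).integrable hF A]
  congr 1
  ext x
  by_cases h : ∃ i ∈ s, x ∈ tsupport (w i)
  · obtain ⟨i, hi, hx⟩ := h
    rw [fderiv_sum_perturbation s hd hi hx]
    refine (Finset.sum_eq_single_of_mem (f := fun j => F (A + fderiv ℝ (w j) x) - F A) i hi
      fun j hj hji => ?_).symm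
    have : x ∉ tsupport (w j) := fun h => (hd hji hj hi).le_bot ⟨h, hx⟩
    simp [fderiv_eq_zero_of_notMem_tsupport this]
  · push Not at h
    have h1 : x ∉ tsupport (fun y => ∑ i ∈ s, w i y) := fun hx => by
      have := tsupport_sum_subset s w hx
      simp only [mem_iUnion] at this
      obtain ⟨i, hi, hx⟩ := this
      exact h i hi hx
    rw [fderiv_eq_zero_of_notMem_tsupport h1, Finset.sum_eq_zero]
    · simp
    · intro i hi
      simp [fderiv_eq_zero_of_notMem_tsupport (h i hi)]

end Perturbation

/-! ### Attainable energies: independence of the domain and stability in the affine state. -/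

section Relaxation

variable {n : ℕ} {V : Type*} [NormedAddCommGroup V] [NormedSpace ℝ V]

/-- The affine state `A` can be perturbed, on some compact domain with nonempty interior, to a map
whose average energy is less than `t`. -/
def Relaxes (F : (Eucl n →L[ℝ] V) → ℝ) (A : Eucl n →L[ℝ] V) (t : ℝ) : Prop :=
  ∃ (C : Set (Eucl n)) (w : Eucl n → V), IsCompact C ∧ (interior C).Nonempty ∧
    IsPerturbation w ∧ tsupport w ⊆ C ∧ excess F A w < (t - F A) * volume.real C

theorem Relaxes.mono {F : (Eucl n →L[ℝ] V) → ℝ} {A : Eucl n →L[ℝ] V} {t t' : ℝ}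
    (h : Relaxes F A t) (htt : t ≤ t') : Relaxes F A t' := by
  obtain ⟨C, w, h1, h2, h3, h4, h5⟩ := h
  refine ⟨C, w, h1, h2, h3, h4, h5.trans_le ?_⟩
  gcongr

theorem measureReal_pos_of_interior_nonempty {C : Set (Eucl n)} (hC : IsCompact C)
    (hi : (interior C).Nonempty) : 0 < volume.real C :=
  ENNReal.toReal_pos (Measure.measure_pos_of_nonempty_interior volume hi).ne' hC.measure_lt_top.ne

theorem Relaxes.of_lt {F : (Eucl n →L[ℝ] V) → ℝ} {A : Eucl n →L[ℝ] V} {t : ℝ}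
    (h : F A < t) : Relaxes F A t := by
  have hi : (interior (Metric.closedBall (0 : Eucl n) 1)).Nonempty :=
    ⟨0, interior_mono Metric.ball_subset_closedBall
      (by rw [Metric.isOpen_ball.interior_eq]; simp)⟩
  have hc := isCompact_closedBall (0 : Eucl n) 1
  refine ⟨Metric.closedBall 0 1, fun _ => 0, hc, hi, IsPerturbation.zero, ?_, ?_⟩
  · simp [tsupport]
  · simp only [excess, fderiv_fun_const, Pi.zero_apply, add_zero, sub_self, integral_zero]
    exact mul_pos (sub_pos.2 h) (measureReal_pos_of_interior_nonempty hc hi)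

theorem Relaxes.neg {F : (Eucl n →L[ℝ] V) → ℝ} (hF : ∀ A, F (-A) = F A) {A : Eucl n →L[ℝ] V}
    {t : ℝ} (h : Relaxes F A t) : Relaxes F (-A) t := by
  obtain ⟨C, w, h1, h2, h3, h4, h5⟩ := h
  refine ⟨C, fun x => -w x, h1, h2, ?_, ?_, ?_⟩
  · exact h3.clm_comp (-ContinuousLinearMap.id ℝ V)
  · refine (closure_mono fun x hx => ?_).trans h4
    simpa using hx
  · have : excess F (-A) (fun x => -w x) = excess F A w := by
      unfold excess
      congr 1
      ext x
      rw [fderiv_fun_neg, ← neg_add, hF, hF]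
    rwa [this, hF]

theorem volume_preimage_rescale (C : Set (Eucl n)) (c : Eucl n) {ρ : ℝ} (hρ : 0 < ρ) :
    volume ((fun y => ρ⁻¹ • (y - c)) ⁻¹' C) = ENNReal.ofReal (ρ ^ n) * volume C := by
  have h1 : (fun y => ρ⁻¹ • (y - c)) ⁻¹' C = (fun y => y - c) ⁻¹' ((fun y => ρ⁻¹ • y) ⁻¹' C) := rfl
  rw [h1, (measurePreserving_sub_right volume c).measure_preimage_emb
    (MeasurableEquiv.subRight c).measurableEmbedding,
    Measure.addHaar_preimage_smul _ (inv_ne_zero hρ.ne')]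
  simp [abs_of_pos hρ]

theorem tsupport_rescale_subset {w : Eucl n → V} {C : Set (Eucl n)} (hw : tsupport w ⊆ C)
    (c : Eucl n) (ρ : ℝ) :
    tsupport (fun y => ρ • w (ρ⁻¹ • (y - c))) ⊆ (fun y => ρ⁻¹ • (y - c)) ⁻¹' C := by
  refine (closure_minimal (fun x hx => ?_)
    ((isClosed_tsupport w).preimage (by fun_prop))).trans (preimage_mono hw)
  refine subset_tsupport w fun h => hx ?_
  simp [h]

/-- Vitali's covering theorem for the scaled and translated copies of a compact set. -/
theorem exists_rescaled_covering {C : Set (Eucl n)} (hC : IsCompact C)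
    (hi : (interior C).Nonempty) {U : Set (Eucl n)} (hU : IsOpen U) :
    ∃ u : Set (Eucl n × ℝ), u.Countable ∧ (∀ a ∈ u, 0 < a.2) ∧
      (∀ a ∈ u, (fun y => a.2⁻¹ • (y - a.1)) ⁻¹' C ⊆ U) ∧
      u.PairwiseDisjoint (fun a => (fun y => a.2⁻¹ • (y - a.1)) ⁻¹' C) ∧
      volume (U \ ⋃ a ∈ u, (fun y => a.2⁻¹ • (y - a.1)) ⁻¹' C) = 0 := by
  obtain ⟨R, hR0, hR⟩ : ∃ R, 0 < R ∧ C ⊆ Metric.closedBall 0 R := by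
    obtain ⟨R, hR⟩ := hC.isBounded.subset_closedBall 0
    exact ⟨max R 1, by positivity, hR.trans (Metric.closedBall_subset_closedBall (le_max_left _ _))⟩
  have hCpos : volume C ≠ 0 := (Measure.measure_pos_of_nonempty_interior volume hi).ne'
  have hCfin : volume C ≠ ⊤ := hC.measure_lt_top.ne
  -- Vitali's theorem compares each copy, of volume `ρ ^ n |C|`, with the threefold enlargement of
  -- its enclosing ball of radius `ρ R`; the ratio `κ` does not depend on `ρ`.
  set κ : ENNReal := ENNReal.ofReal ((3 * R) ^ n) * volume (Metric.ball (0 : Eucl n) 1) / volume C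
    with hκ
  have hκfin : κ ≠ ⊤ := ENNReal.div_ne_top
    (ENNReal.mul_ne_top ENNReal.ofReal_ne_top measure_ball_lt_top.ne) hCpos
  have hsub : ∀ a : Eucl n × ℝ, 0 < a.2 →
      (fun y => a.2⁻¹ • (y - a.1)) ⁻¹' C ⊆ Metric.closedBall a.1 (a.2 * R) := by
    intro a ha y hy
    have := hR hy
    rw [mem_closedBall_zero_iff, norm_smul, norm_inv, Real.norm_of_nonneg ha.le,
      inv_mul_le_iff₀ ha] at this
    rwa [mem_closedBall_iff_norm]
  have hvol : ∀ a ∈ {a : Eucl n × ℝ | 0 < a.2 ∧ Metric.closedBall a.1 (a.2 * R) ⊆ U},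
      volume (Metric.closedBall a.1 (3 * (a.2 * R))) ≤
        κ.toNNReal * volume ((fun y => a.2⁻¹ • (y - a.1)) ⁻¹' C) := by
    rintro ⟨c, ρ⟩ ⟨hρ, -⟩
    simp only at hρ ⊢
    rw [volume_preimage_rescale C c hρ, Measure.addHaar_closedBall _ _ (by positivity),
      ENNReal.coe_toNNReal hκfin, hκ, mul_left_comm (_ / _), ENNReal.div_mul_cancel hCpos hCfin,
      ← mul_assoc (ENNReal.ofReal _), ← ENNReal.ofReal_mul (by positivity)]
    simp only [finrank_euclideanSpace, Fintype.card_fin]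
    rw [← mul_pow, mul_left_comm]
  have hint : ∀ a ∈ {a : Eucl n × ℝ | 0 < a.2 ∧ Metric.closedBall a.1 (a.2 * R) ⊆ U},
      (interior ((fun y => a.2⁻¹ • (y - a.1)) ⁻¹' C)).Nonempty := by
    rintro ⟨c, ρ⟩ ⟨hρ, -⟩
    obtain ⟨z, hz⟩ := hi
    refine ⟨c + ρ • z, preimage_interior_subset_interior_preimage (by fun_prop) ?_⟩
    simp only at hρ
    simpa [smul_smul, hρ.ne'] using hz
  have hfine : ∀ x ∈ U, ∀ ε > (0 : ℝ),
      ∃ a ∈ {a : Eucl n × ℝ | 0 < a.2 ∧ Metric.closedBall a.1 (a.2 * R) ⊆ U},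
        a.2 * R ≤ ε ∧ a.1 = x := by
    intro x hx ε hε
    obtain ⟨δ, hδ, hδU⟩ := Metric.nhds_basis_closedBall.mem_iff.1 (hU.mem_nhds hx)
    refine ⟨(x, min ε δ / R), ⟨by positivity, ?_⟩, ?_, rfl⟩
    · simp only [div_mul_cancel₀ _ hR0.ne']
      exact (Metric.closedBall_subset_closedBall (min_le_right _ _)).trans hδU
    · simp only [div_mul_cancel₀ _ hR0.ne']
      exact min_le_left _ _
  obtain ⟨u, hut, hcount, hdisj, hnull⟩ := Vitali.exists_disjoint_covering_ae volume U
    {a : Eucl n × ℝ | 0 < a.2 ∧ Metric.closedBall a.1 (a.2 * R) ⊆ U} κ.toNNReal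
    (fun a => a.2 * R) (fun a => a.1) (fun a => (fun y => a.2⁻¹ • (y - a.1)) ⁻¹' C)
    (fun a ha => hsub a ha.1) hvol hint (fun a _ => hC.isClosed.preimage (by fun_prop)) hfine
  exact ⟨u, hcount, fun a ha => (hut ha).1, fun a ha => (hsub a (hut ha).1).trans (hut ha).2,
    hdisj, hnull⟩

variable [FiniteDimensional ℝ V]

/-- Disjoint scaled copies of the model domain exhaust `U` up to a null set, and each contributes
excess in proportion to its volume. The average energy is therefore independent of the domain. -/
theorem Relaxes.exists_on_open {F : (Eucl n →L[ℝ] V) → ℝ} (hF : Continuous F)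
    {A : Eucl n →L[ℝ] V} {t : ℝ} (h : Relaxes F A t) {U : Set (Eucl n)} (hU : IsOpen U)
    (hb : Bornology.IsBounded U) (hne : U.Nonempty) :
    ∃ w : Eucl n → V, IsPerturbation w ∧ tsupport w ⊆ U ∧
      excess F A w < (t - F A) * volume.real U := by
  obtain ⟨C, w, hC, hi, hw, hwC, hlt⟩ := h
  have hCpos := measureReal_pos_of_interior_nonempty hC hi
  have hUpos : 0 < volume.real U :=
    ENNReal.toReal_pos (hU.measure_pos volume hne).ne' hb.measure_lt_top.ne
  obtain ⟨u, hcount, hpos, hsub, hdisj, hnull⟩ := exists_rescaled_covering hC hi hU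
  have hcl : ∀ a : Eucl n × ℝ, IsClosed ((fun y => a.2⁻¹ • (y - a.1)) ⁻¹' C) :=
    fun a => hC.isClosed.preimage (by fun_prop)
  have hsum : HasSum (fun a : u => a.1.2 ^ n * volume.real C) (volume.real U) := by
    have h1 : volume U = ∑' a : u, volume ((fun y => a.1.2⁻¹ • (y - a.1.1)) ⁻¹' C) := by
      rw [← measure_biUnion hcount hdisj fun a _ => (hcl a).measurableSet]
      exact (measure_eq_measure_of_null_sdiff (iUnion₂_subset hsub) hnull).symm
    have h2 : volume U ≠ ⊤ := hb.measure_lt_top.ne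
    have h3 := ENNReal.hasSum_toReal (h1 ▸ h2)
    rw [← ENNReal.tsum_toReal_eq
      (fun a : u => ne_top_of_le_ne_top h2 (measure_mono (hsub a.1 a.2))), ← h1] at h3
    convert h3 using 2 with a
    rw [volume_preimage_rescale C _ (hpos a a.2), ENNReal.toReal_mul,
      ENNReal.toReal_ofReal (by have := hpos a a.2; positivity)]
    all_goals rfl
  have hlim := hsum.mul_right (excess F A w / volume.real C)
  have hlt' : volume.real U * (excess F A w / volume.real C) < (t - F A) * volume.real U := by
    rw [mul_comm]
    exact mul_lt_mul_of_pos_right ((div_lt_iff₀ hCpos).2 hlt) hUpos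
  -- The inequality is strict, so it already holds for a finite subfamily; the resulting finite sum
  -- is again a perturbation.
  obtain ⟨s, hs⟩ := ((tendsto_order.1 hlim).2 _ hlt').exists
  have hp : ∀ a ∈ s, IsPerturbation fun y => a.1.2 • w (a.1.2⁻¹ • (y - a.1.1)) :=
    fun a _ => hw.rescale _ (hpos a a.2)
  refine ⟨fun y => ∑ a ∈ s, a.1.2 • w (a.1.2⁻¹ • (y - a.1.1)), IsPerturbation.sum s hp, ?_, ?_⟩
  · refine (tsupport_sum_subset s _).trans (iUnion₂_subset fun a _ => ?_)
    exact (tsupport_rescale_subset hwC a.1.1 a.1.2).trans (hsub a a.2)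
  · rw [excess_sum hF A s hp]
    · refine lt_of_eq_of_lt (Finset.sum_congr rfl fun a _ => ?_) hs
      rw [excess_rescale F A w _ (hpos a a.2)]
      field_simp
    · intro a b hab _ _
      exact (hdisj a.2 b.2 fun h => hab (Subtype.ext h)).mono
        (tsupport_rescale_subset hwC _ _) (tsupport_rescale_subset hwC _ _)

theorem continuous_excess {F : (Eucl n →L[ℝ] V) → ℝ} (hF : Continuous F) {w : Eucl n → V}
    (hw : IsPerturbation w) : Continuous fun A => excess F A w := by
  rw [continuous_iff_continuousAt]
  intro A
  obtain ⟨K, hK⟩ := hw.lipschitz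
  obtain ⟨M, hM⟩ := exists_bound_comp_fderiv hF A 1 K
  refine continuousAt_of_dominated (bound := (tsupport w).indicator fun _ => M)
    (Eventually.of_forall fun A' => (measurable_comp_fderiv hF A' w).aestronglyMeasurable)
    ?_ ?_ (Eventually.of_forall fun x => ?_)
  · filter_upwards [Metric.closedBall_mem_nhds A one_pos] with A' hA'
    refine Eventually.of_forall fun x => ?_
    by_cases hx : x ∈ tsupport w
    · rw [indicator_of_mem hx]
      exact hM A' _ (by simpa [dist_eq_norm] using hA') (norm_fderiv_le_of_lipschitz ℝ hK)
    · simp [indicator_of_notMem hx, fderiv_eq_zero_of_notMem_tsupport hx]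
  · rw [integrable_indicator_iff (isClosed_tsupport w).measurableSet]
    exact integrableOn_const hw.compact.isCompact.measure_lt_top.ne
  · exact Continuous.continuousAt (by fun_prop)

/-- The same perturbation works for nearby states, because both sides of the strict inequality are
continuous in `A`. This absorbs the small transversal slopes of the diamond construction. -/
theorem Relaxes.eventually_nhds {F : (Eucl n →L[ℝ] V) → ℝ} (hF : Continuous F)
    {A : Eucl n →L[ℝ] V} {t : ℝ} (h : Relaxes F A t) : ∀ᶠ A' in 𝓝 A, Relaxes F A' t := by
  obtain ⟨C, w, h1, h2, h3, h4, h5⟩ := h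
  have hr : Continuous fun A => (t - F A) * volume.real C := by fun_prop
  filter_upwards [(continuous_excess hF h3).continuousAt.eventually_lt hr.continuousAt h5]
    with A' hA' using ⟨C, w, h1, h2, h3, h4, hA'⟩

end Relaxation

/-! ### A bump on a diamond with four affine pieces, close to a simple laminate. -/

section Diamond

/-- The sign attached to a Boolean. -/
def boolSign (b : Bool) : ℝ := if b then 1 else -1

/-- The slopes `1 - l` and `-l` of the two sides of a tent. -/
def tentSlope (l : ℝ) (b : Bool) : ℝ := if b then 1 - l else -l

/-- The derivatives of the four affine pieces of `diamondBump`. -/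
noncomputable def diamondForm (i j : Fin 2) (l δ : ℝ) (σ : Bool × Bool) : Eucl 2 →L[ℝ] ℝ :=
  tentSlope l σ.1 • EuclideanSpace.proj i - (δ * boolSign σ.2) • EuclideanSpace.proj j

theorem diamondForm_apply (i j : Fin 2) (l δ : ℝ) (σ : Bool × Bool) (x : Eucl 2) :
    diamondForm i j l δ σ x = tentSlope l σ.1 * x i - δ * boolSign σ.2 * x j := rfl

/-- The concave piecewise affine function whose positive part is `diamondBump`. -/
noncomputable def diamondHeight (i j : Fin 2) (l δ : ℝ) (x : Eucl 2) : ℝ :=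
  l * (1 - l) + min ((1 - l) * x i) (-l * x i) - δ * |x j|

/-- A piecewise affine function with compact support and small slope in direction `j`. -/
noncomputable def diamondBump (i j : Fin 2) (l δ : ℝ) (x : Eucl 2) : ℝ :=
  max 0 (diamondHeight i j l δ x)

/-- The open diamond on which `diamondBump` is positive. -/
def diamond (i j : Fin 2) (l δ : ℝ) : Set (Eucl 2) := {x | 0 < diamondHeight i j l δ x}

/-- The four open triangles on which `diamondBump` is affine. -/
def diamondPiece (i j : Fin 2) (l δ : ℝ) (σ : Bool × Bool) : Set (Eucl 2) :=
  diamond i j l δ ∩ {x | boolSign σ.1 * x i < 0 ∧ 0 < boolSign σ.2 * x j}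

variable {i j : Fin 2} {l δ : ℝ}

theorem continuous_diamondHeight : Continuous (diamondHeight i j l δ) := by
  unfold diamondHeight; fun_prop

theorem isOpen_diamond : IsOpen (diamond i j l δ) :=
  isOpen_lt continuous_const continuous_diamondHeight

theorem isOpen_diamondPiece (σ : Bool × Bool) : IsOpen (diamondPiece i j l δ σ) :=
  isOpen_diamond.inter (.and (isOpen_lt (by fun_prop) continuous_const)
    (isOpen_lt continuous_const (by fun_prop)))

/-- The height is a minimum of four affine functions, so the diamond is an intersection of
half-planes. Convexity serves to make its frontier a null set. -/
theorem convex_diamond (hδ : 0 < δ) : Convex ℝ (diamond i j l δ) := by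
  have h : diamond i j l δ =
      ⋂ σ : Bool × Bool, {x | -(l * (1 - l)) < diamondForm i j l δ σ x} := by
    ext x
    simp only [diamond, diamondHeight, mem_ofPred_eq, mem_iInter, Prod.forall, Bool.forall_bool,
      diamondForm_apply, tentSlope, boolSign, Bool.false_eq_true, if_true, if_false]
    have h1 := mul_le_mul_of_nonneg_left (le_abs_self (x j)) hδ.le
    have h2 := mul_le_mul_of_nonneg_left (neg_le_abs (x j)) hδ.le
    have h3 := min_le_left ((1 - l) * x i) (-l * x i)
    have h4 := min_le_right ((1 - l) * x i) (-l * x i)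
    constructor
    · intro h
      refine ⟨⟨?_, ?_⟩, ⟨?_, ?_⟩⟩ <;> linarith
    · rintro ⟨⟨h5, h6⟩, ⟨h7, h8⟩⟩
      rcases min_choice ((1 - l) * x i) (-l * x i) with h | h <;>
      rcases abs_choice (x j) with h' | h' <;> rw [h, h'] <;> linarith
  rw [h]
  exact convex_iInter fun σ => convex_halfSpace_gt (diamondForm i j l δ σ).isLinear _

theorem diamondBump_eq_of_mem {σ : Bool × Bool} {x : Eucl 2} (h : x ∈ diamondPiece i j l δ σ) :
    diamondBump i j l δ x = diamondForm i j l δ σ x + l * (1 - l) := by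
  obtain ⟨h1, h2, h3⟩ := h
  rw [diamondBump, max_eq_right (le_of_lt h1), diamondForm_apply, diamondHeight]
  obtain ⟨a, b⟩ := σ
  have hmin : min ((1 - l) * x i) (-l * x i) = tentSlope l a * x i := by
    cases a <;> simp only [boolSign, tentSlope, Bool.false_eq_true, if_true, if_false] at h2 ⊢
    · exact min_eq_right (by linarith)
    · exact min_eq_left (by linarith)
  have habs : |x j| = boolSign b * x j := by
    cases b <;> simp only [boolSign, Bool.false_eq_true, if_true, if_false] at h3 ⊢
    · rw [abs_of_neg (by linarith)]; ring
    · rw [abs_of_pos (by linarith)]; ring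
  rw [hmin, habs]; ring

theorem diamondBump_eq_zero {x : Eucl 2} (h : x ∉ diamond i j l δ) :
    diamondBump i j l δ x = 0 :=
  max_eq_left (not_lt.1 h)

theorem isBounded_diamond (hij : i ≠ j) (h0 : 0 < l) (h1 : l < 1) (hδ : 0 < δ) :
    Bornology.IsBounded (diamond i j l δ) := by
  refine (isBounded_iff_forall_norm_le).2 ⟨1 + l * (1 - l) / δ, fun x hx => ?_⟩
  have hx' : 0 < l * (1 - l) + min ((1 - l) * x i) (-l * x i) - δ * |x j| := hx
  have hl : 0 < 1 - l := sub_pos.2 h1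
  have h3 := min_le_left ((1 - l) * x i) (-l * x i)
  have h4 := min_le_right ((1 - l) * x i) (-l * x i)
  have hi : |x i| ≤ 1 := by
    have := mul_nonneg hδ.le (abs_nonneg (x j))
    rw [abs_le]
    constructor
    · by_contra h; nlinarith
    · by_contra h; nlinarith
  have hj : |x j| ≤ l * (1 - l) / δ := by
    rw [le_div_iff₀ hδ]
    have : min ((1 - l) * x i) (-l * x i) ≤ 0 := by
      rcases le_total (x i) 0 with h | h
      · exact h3.trans (mul_nonpos_of_nonneg_of_nonpos hl.le h)
      · exact h4.trans (by nlinarith)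
    linarith
  have hsum : ‖x‖ ^ 2 = x i ^ 2 + x j ^ 2 := by
    rw [EuclideanSpace.real_norm_sq_eq, Fin.sum_univ_two]
    fin_cases i <;> fin_cases j <;> simp_all [add_comm]
  have h5 : ‖x‖ ≤ |x i| + |x j| := by
    refine abs_le_of_sq_le_sq' ?_ (by positivity) |>.2
    rw [hsum, add_sq, sq_abs, sq_abs]
    have := mul_nonneg (abs_nonneg (x i)) (abs_nonneg (x j))
    linarith
  linarith

theorem lipschitzWith_coordinate (i : Fin 2) : LipschitzWith 1 fun x : Eucl 2 => x i :=
  LipschitzWith.of_dist_le_mul fun x y => by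
    simpa [dist_eq_norm] using PiLp.norm_apply_le (x - y) i

theorem exists_lipschitzWith_diamondBump : ∃ K, LipschitzWith K (diamondBump i j l δ) := by
  have hi : ∀ c : ℝ, ∃ K, LipschitzWith K fun x : Eucl 2 => c * x i := fun c =>
    ⟨_, (lipschitzWith_smul c).comp (lipschitzWith_coordinate i)⟩
  obtain ⟨K1, hK1⟩ := hi (1 - l)
  obtain ⟨K2, hK2⟩ := hi (-l)
  have h3 : LipschitzWith (‖δ‖₊ * 1) fun x : Eucl 2 => δ * |x j| :=
    (lipschitzWith_smul δ).comp
      ((lipschitzWith_one_norm (E := ℝ)).comp (lipschitzWith_coordinate j) |>.weaken (by simp))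
  exact ⟨_, ((((LipschitzWith.const (l * (1 - l))).add (hK1.min hK2)).sub h3).const_max 0)⟩

theorem volume_coordinate_eq_zero (i : Fin 2) : volume {x : Eucl 2 | x i = 0} = 0 := by
  have h : {x : Eucl 2 | x i = 0} =
      ((LinearMap.ker (EuclideanSpace.proj i : Eucl 2 →L[ℝ] ℝ).toLinearMap : Submodule ℝ (Eucl 2)) :
        Set (Eucl 2)) := by
    ext x; simp
  rw [h]
  refine Measure.addHaar_submodule _ _ fun htop => ?_
  have : EuclideanSpace.single i (1 : ℝ) ∈
      LinearMap.ker (EuclideanSpace.proj i : Eucl 2 →L[ℝ] ℝ).toLinearMap := htop ▸ trivial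
  simp at this

theorem disjoint_diamondPiece {σ τ : Bool × Bool} (h : σ ≠ τ) :
    Disjoint (diamondPiece i j l δ σ) (diamondPiece i j l δ τ) := by
  rw [Set.disjoint_left]
  rintro x ⟨-, h1, h2⟩ ⟨-, h3, h4⟩
  apply h
  obtain ⟨a, b⟩ := σ
  obtain ⟨c, d⟩ := τ
  cases a <;> cases b <;> cases c <;> cases d <;>
    simp only [boolSign, Bool.false_eq_true, if_true, if_false] at h1 h2 h3 h4 ⊢ <;> linarith

/-- Almost every point lies in one of the four triangles or outside the closed diamond. -/
theorem ae_mem_diamondPiece_or (hδ : 0 < δ) :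
    ∀ᵐ x : Eucl 2, (∃ σ, x ∈ diamondPiece i j l δ σ) ∨ x ∉ closure (diamond i j l δ) := by
  have h1 : ∀ᵐ x : Eucl 2, x i ≠ 0 :=
    measure_eq_zero_iff_ae_notMem.1 (volume_coordinate_eq_zero i)
  have h2 : ∀ᵐ x : Eucl 2, x j ≠ 0 :=
    measure_eq_zero_iff_ae_notMem.1 (volume_coordinate_eq_zero j)
  have h3 : ∀ᵐ x : Eucl 2, x ∉ frontier (diamond i j l δ) :=
    measure_eq_zero_iff_ae_notMem.1 ((convex_diamond hδ).addHaar_frontier volume)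
  filter_upwards [h1, h2, h3] with x h1 h2 h3
  by_cases hx : x ∈ closure (diamond i j l δ)
  · left
    have hD : x ∈ diamond i j l δ := by
      by_contra h
      exact h3 ⟨hx, by rwa [isOpen_diamond.interior_eq]⟩
    refine ⟨(decide (x i < 0), decide (0 < x j)), hD, ?_, ?_⟩
    · by_cases h : x i < 0
      · simp [boolSign, h]
      · simp only [boolSign, h, decide_false, Bool.false_eq_true, if_false]
        have := lt_of_le_of_ne (not_lt.1 h) h1.symm
        linarith
    · by_cases h : 0 < x j
      · simp [boolSign, h]
      · simp only [boolSign, h, decide_false, Bool.false_eq_true, if_false]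
        have := lt_of_le_of_ne (not_lt.1 h) h2
        linarith
  · exact Or.inr hx

theorem nonempty_diamondPiece (hij : i ≠ j) (h0 : 0 < l) (h1 : l < 1) (σ : Bool × Bool) :
    (diamondPiece i j l δ σ).Nonempty := by
  -- `v` points into the quadrant of `σ`; a small multiple of it stays in the diamond because the
  -- height at the origin is `l * (1 - l) > 0`.
  set v : Eucl 2 := EuclideanSpace.single i (-boolSign σ.1) + EuclideanSpace.single j (boolSign σ.2)
    with hv
  have hc : Continuous fun ε : ℝ => diamondHeight i j l δ (ε • v) :=
    continuous_diamondHeight.comp (by fun_prop)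
  have hpos : 0 < diamondHeight i j l δ ((0 : ℝ) • v) := by
    simp only [diamondHeight, zero_smul, PiLp.zero_apply, mul_zero, min_self, abs_zero]
    nlinarith
  have hev : ∀ᶠ ε : ℝ in 𝓝[>] 0, 0 < diamondHeight i j l δ (ε • v) :=
    (hc.continuousAt.eventually (lt_mem_nhds hpos)).filter_mono nhdsWithin_le_nhds
  obtain ⟨ε, hε, hε0⟩ := (hev.and self_mem_nhdsWithin).exists
  have hvi : v i = -boolSign σ.1 := by simp [hv, hij]
  have hvj : v j = boolSign σ.2 := by simp [hv, hij.symm]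
  have hsq : ∀ b, boolSign b * boolSign b = 1 := by intro b; cases b <;> simp [boolSign]
  refine ⟨ε • v, hε, ?_, ?_⟩
  · rw [PiLp.smul_apply, hvi, smul_eq_mul]
    linear_combination hε0 - ε * hsq σ.1
  · rw [PiLp.smul_apply, hvj, smul_eq_mul]
    linear_combination hε0 - ε * hsq σ.2

theorem isPerturbation_diamondBump (hij : i ≠ j) (h0 : 0 < l) (h1 : l < 1) (hδ : 0 < δ) :
    IsPerturbation (diamondBump i j l δ) where
  lipschitz := exists_lipschitzWith_diamondBump
  compact := HasCompactSupport.intro (isBounded_diamond hij h0 h1 hδ).isCompact_closure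
    fun _ hx => diamondBump_eq_zero fun h => hx (subset_closure h)
  affine := by
    filter_upwards [ae_mem_diamondPiece_or (i := i) (j := j) (l := l) hδ] with x hx
    rcases hx with ⟨σ, hσ⟩ | hx
    · refine LocallyAffineAt.of_eventually_eq (L := diamondForm i j l δ σ) (c := l * (1 - l)) ?_
      filter_upwards [(isOpen_diamondPiece σ).mem_nhds hσ] with y hy
        using diamondBump_eq_of_mem hy
    · refine LocallyAffineAt.of_eventually_eq (L := 0) (c := 0) ?_
      filter_upwards [isClosed_closure.isOpen_compl.mem_nhds hx] with y hy
      rw [diamondBump_eq_zero fun h => hy (subset_closure h)]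
      simp

theorem integral_sum_indicator_diamondPiece (hij : i ≠ j) (h0 : 0 < l) (h1 : l < 1) (hδ : 0 < δ)
    (c : Bool × Bool → ℝ) :
    Integrable (fun x => ∑ σ, (diamondPiece i j l δ σ).indicator (fun _ => c σ) x) ∧
    ∫ x, ∑ σ, (diamondPiece i j l δ σ).indicator (fun _ => c σ) x =
      ∑ σ, c σ * volume.real (diamondPiece i j l δ σ) := by
  have hint : ∀ σ ∈ (Finset.univ : Finset (Bool × Bool)),
      Integrable (fun x => (diamondPiece i j l δ σ).indicator (fun _ => c σ) x) := by
    intro σ _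
    rw [integrable_indicator_iff (isOpen_diamondPiece σ).measurableSet]
    exact integrableOn_const
      (((isBounded_diamond hij h0 h1 hδ).subset inter_subset_left).measure_lt_top.ne)
  refine ⟨integrable_finsetSum _ hint, ?_⟩
  rw [integral_finsetSum _ hint]
  refine Finset.sum_congr rfl fun σ _ => ?_
  rw [integral_indicator (isOpen_diamondPiece σ).measurableSet, setIntegral_const, smul_eq_mul,
    mul_comm]

theorem sum_indicator_diamondPiece {σ : Bool × Bool} {x : Eucl 2}
    (hx : x ∈ diamondPiece i j l δ σ) (c : Bool × Bool → ℝ) :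
    ∑ τ, (diamondPiece i j l δ τ).indicator (fun _ => c τ) x = c σ := by
  rw [Finset.sum_eq_single σ, indicator_of_mem hx]
  · intro τ _ hτ
    exact indicator_of_notMem (fun h => (disjoint_diamondPiece hτ).le_bot ⟨h, hx⟩) _
  · simp

theorem sum_indicator_diamondPiece_of_notMem {x : Eucl 2} (hx : x ∉ closure (diamond i j l δ))
    (c : Bool × Bool → ℝ) :
    ∑ τ, (diamondPiece i j l δ τ).indicator (fun _ => c τ) x = 0 :=
  Finset.sum_eq_zero fun _ _ => indicator_of_notMem (fun h => hx (subset_closure h.1)) _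

theorem sum_volume_diamondPiece (hij : i ≠ j) (h0 : 0 < l) (h1 : l < 1) (hδ : 0 < δ) :
    ∑ σ, volume.real (diamondPiece i j l δ σ) = volume.real (closure (diamond i j l δ)) := by
  have h := (integral_sum_indicator_diamondPiece hij h0 h1 hδ fun _ => 1).2
  simp only [one_mul] at h
  rw [← h, ← mul_one (volume.real _), ← smul_eq_mul, ← setIntegral_const,
    ← integral_indicator isClosed_closure.measurableSet]
  refine integral_congr_ae ?_
  filter_upwards [ae_mem_diamondPiece_or (i := i) (j := j) (l := l) hδ] with x hx
  rcases hx with ⟨σ, hσ⟩ | hx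
  · rw [sum_indicator_diamondPiece hσ, indicator_of_mem (subset_closure hσ.1)]
  · rw [sum_indicator_diamondPiece_of_notMem hx, indicator_of_notMem hx]

theorem hasFDerivAt_diamondBump {σ : Bool × Bool} {x : Eucl 2} (hx : x ∈ diamondPiece i j l δ σ) :
    HasFDerivAt (diamondBump i j l δ) (diamondForm i j l δ σ) x := by
  refine ((diamondForm i j l δ σ).hasFDerivAt.add_const (l * (1 - l))).congr_of_eventuallyEq ?_
  filter_upwards [(isOpen_diamondPiece σ).mem_nhds hx] with y hy using diamondBump_eq_of_mem hy

theorem tsupport_diamondBump_subset :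
    tsupport (diamondBump i j l δ) ⊆ closure (diamond i j l δ) :=
  closure_mono fun _ hx => by_contra fun h => hx (diamondBump_eq_zero h)

theorem IsPerturbation.integral_fderiv_apply {n : ℕ} {w : Eucl n → ℝ} (hw : IsPerturbation w)
    (v : Eucl n) : ∫ x, fderiv ℝ w x v = 0 := by
  obtain ⟨K, hK⟩ := hw.lipschitz
  have h := LipschitzWith.integral_lineDeriv_mul_eq (μ := volume)
    (LipschitzWith.const (1 : ℝ) : LipschitzWith 0 fun _ : Eucl n => (1 : ℝ)) hK hw.compact (-v)
  have h0 : ∀ x, lineDeriv ℝ (fun _ : Eucl n => (1 : ℝ)) x (-v) = 0 := fun x => by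
    simp [lineDeriv]
  simp only [h0, zero_mul, integral_zero, neg_neg, mul_one] at h
  rw [h]
  refine integral_congr_ae ?_
  filter_upwards [hw.affine] with x hx
  exact hx.differentiableAt.lineDeriv_eq_fderiv.symm

/-- The derivative of a compactly supported function in direction `i` has integral zero. This fixes
the area fractions of the two slopes as `l` and `1 - l` without computing any triangle. -/
theorem sum_tentSlope_mul_volume (hij : i ≠ j) (h0 : 0 < l) (h1 : l < 1) (hδ : 0 < δ) :
    ∑ σ : Bool × Bool, tentSlope l σ.1 * volume.real (diamondPiece i j l δ σ) = 0 := by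
  rw [← (integral_sum_indicator_diamondPiece hij h0 h1 hδ fun σ => tentSlope l σ.1).2,
    ← (isPerturbation_diamondBump hij h0 h1 hδ).integral_fderiv_apply
      (EuclideanSpace.single i 1)]
  refine integral_congr_ae ?_
  filter_upwards [ae_mem_diamondPiece_or (i := i) (j := j) (l := l) hδ] with x hx
  rcases hx with ⟨σ, hσ⟩ | hx
  · rw [sum_indicator_diamondPiece hσ, (hasFDerivAt_diamondBump hσ).fderiv, diamondForm_apply]
    simp [hij.symm]
  · rw [sum_indicator_diamondPiece_of_notMem hx,
      fderiv_eq_zero_of_notMem_tsupport fun h => hx (tsupport_diamondBump_subset h)]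
    simp

end Diamond

/-! ### Averaging attainable energies along rank-one segments. -/

section RankOne

variable {V : Type*} [NormedAddCommGroup V] [NormedSpace ℝ V] [FiniteDimensional ℝ V]

/-- A diamond bump in the direction `a`, perturbed further inside each of its four pieces. -/
theorem excess_diamondBump_add {F : (Eucl 2 →L[ℝ] V) → ℝ} (hF : Continuous F)
    (A : Eucl 2 →L[ℝ] V) (a : V) {i j : Fin 2} {l δ : ℝ} (hij : i ≠ j) (h0 : 0 < l) (h1 : l < 1)
    (hδ : 0 < δ) {w : Bool × Bool → Eucl 2 → V} (hw : ∀ σ, IsPerturbation (w σ))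
    (hsupp : ∀ σ, tsupport (w σ) ⊆ diamondPiece i j l δ σ) :
    excess F A (fun x => diamondBump i j l δ x • a + ∑ σ, w σ x) =
      ∑ σ, (excess F (A + (diamondForm i j l δ σ).smulRight a) (w σ) +
        (F (A + (diamondForm i j l δ σ).smulRight a) - F A) *
          volume.real (diamondPiece i j l δ σ)) := by
  set B := fun σ => A + (diamondForm i j l δ σ).smulRight a with hB
  have hint := integral_sum_indicator_diamondPiece hij h0 h1 hδ fun σ => F (B σ) - F A
  have hint' : ∀ σ ∈ Finset.univ, Integrable fun x => F (B σ + fderiv ℝ (w σ) x) - F (B σ) :=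
    fun σ _ => (hw σ).integrable hF (B σ)
  rw [Finset.sum_add_distrib, ← hint.2]
  unfold excess
  rw [← integral_finsetSum _ hint', ← integral_add (integrable_finsetSum _ hint') hint.1]
  refine integral_congr_ae ?_
  have haff : ∀ᵐ x, ∀ σ, LocallyAffineAt (w σ) x := ae_all_iff.2 fun σ => (hw σ).affine
  filter_upwards [ae_mem_diamondPiece_or (i := i) (j := j) (l := l) hδ, haff] with x hx haff
  rcases hx with ⟨σ, hσ⟩ | hx
  · have hout : ∀ τ, τ ≠ σ → ∀ y ∈ diamondPiece i j l δ σ, y ∉ tsupport (w τ) := fun τ hτ y hy h =>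
      (disjoint_diamondPiece hτ).le_bot ⟨hsupp τ h, hy⟩
    have hd : HasFDerivAt (fun x => diamondBump i j l δ x • a + ∑ σ, w σ x)
        ((diamondForm i j l δ σ).smulRight a + fderiv ℝ (w σ) x) x := by
      refine (((hasFDerivAt_diamondBump hσ).smul_const a).add
        (haff σ).differentiableAt.hasFDerivAt).congr_of_eventuallyEq ?_
      filter_upwards [(isOpen_diamondPiece σ).mem_nhds hσ] with y hy
      simp only [Pi.add_apply]
      rw [Finset.sum_eq_single_of_mem σ (Finset.mem_univ σ)]
      exact fun τ _ hτ => image_eq_zero_of_notMem_tsupport (hout τ hτ y hy)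
    rw [hd.fderiv, sum_indicator_diamondPiece hσ,
      Finset.sum_eq_single_of_mem σ (Finset.mem_univ σ), ← add_assoc]
    · ring
    · intro τ _ hτ
      simp [fderiv_eq_zero_of_notMem_tsupport (hout τ hτ x hσ)]
  · have hout : ∀ τ, x ∉ tsupport (w τ) := fun τ h => hx (subset_closure (hsupp τ h).1)
    have hd : fderiv ℝ (fun x => diamondBump i j l δ x • a + ∑ σ, w σ x) x = 0 := by
      apply fderiv_eq_zero_of_notMem_tsupport
      rw [notMem_tsupport_iff_eventuallyEq]
      have h2 := fun τ => notMem_tsupport_iff_eventuallyEq.1 (hout τ)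
      filter_upwards [isClosed_closure.isOpen_compl.mem_nhds hx, eventually_all.2 h2] with y hy hy2
      rw [diamondBump_eq_zero fun h => hy (subset_closure h)]
      simp only [Pi.zero_apply] at hy2
      simp [hy2]
    rw [hd, sum_indicator_diamondPiece_of_notMem hx, Finset.sum_eq_zero]
    · simp
    · intro τ _
      simp [fderiv_eq_zero_of_notMem_tsupport (hout τ)]

/-- A diamond bump in the direction `a` takes the state `A` to states within `O(δ)` of `B` and `C`,
on area fractions `l` and `1 - l`. For small `δ` these still relax to `s` and `t`, and the
corresponding perturbations are inserted into the four triangles. -/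
theorem Relaxes.rankOne {F : (Eucl 2 →L[ℝ] V) → ℝ} (hF : Continuous F) (i : Fin 2) {a : V}
    {B C : Eucl 2 →L[ℝ] V}
    (hBC : B - C = (EuclideanSpace.proj i : Eucl 2 →L[ℝ] ℝ).smulRight a)
    {l s t : ℝ} (h0 : 0 < l) (h1 : l < 1) (hB : Relaxes F B s) (hC : Relaxes F C t) :
    Relaxes F (l • B + (1 - l) • C) (l * s + (1 - l) * t) := by
  obtain ⟨j, hij⟩ : ∃ j : Fin 2, i ≠ j := ⟨i + 1, by fin_cases i <;> simp⟩
  set A := l • B + (1 - l) • C with hA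
  set T : Bool → ℝ := fun b => if b then s else t with hT
  have hform : ∀ δ σ, A + (diamondForm i j l δ σ).smulRight a =
      (if σ.1 then B else C) - (δ * boolSign σ.2) •
        (EuclideanSpace.proj j : Eucl 2 →L[ℝ] ℝ).smulRight a := by
    intro δ σ
    have h2 : (diamondForm i j l δ σ).smulRight a = tentSlope l σ.1 • (B - C) -
        (δ * boolSign σ.2) • (EuclideanSpace.proj j : Eucl 2 →L[ℝ] ℝ).smulRight a := by
      rw [hBC]
      ext x
      simp [diamondForm_apply, sub_smul, mul_smul]
    rw [h2, hA]
    obtain ⟨b, c⟩ := σ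
    cases b <;> simp only [tentSlope, Bool.false_eq_true, if_true, if_false] <;> module
  have hev : ∀ σ : Bool × Bool, ∀ᶠ δ : ℝ in 𝓝[>] 0,
      Relaxes F (A + (diamondForm i j l δ σ).smulRight a) (T σ.1) := by
    intro σ
    have hlim : Tendsto (fun δ : ℝ => A + (diamondForm i j l δ σ).smulRight a) (𝓝[>] 0)
        (𝓝 (if σ.1 then B else C)) := by
      simp only [hform]
      refine tendsto_nhdsWithin_of_tendsto_nhds (Continuous.tendsto' (by fun_prop) _ _ ?_)
      simp
    refine hlim.eventually (p := fun A' => Relaxes F A' (T σ.1)) ?_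
    obtain ⟨b, c⟩ := σ
    cases b
    · simpa [hT] using hC.eventually_nhds hF
    · simpa [hT] using hB.eventually_nhds hF
  obtain ⟨δ, hrel, hδ⟩ := ((eventually_all.2 hev).and self_mem_nhdsWithin).exists
  have hbd := isBounded_diamond hij h0 h1 hδ
  choose w hw hsupp hlt using fun σ => (hrel σ).exists_on_open hF (isOpen_diamondPiece σ)
    (hbd.subset inter_subset_left) (nonempty_diamondPiece hij h0 h1 σ)
  refine ⟨closure (diamond i j l δ), fun x => diamondBump i j l δ x • a + ∑ σ, w σ x,
    hbd.isCompact_closure, ?_, ?_, ?_, ?_⟩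
  · obtain ⟨x, hx⟩ := nonempty_diamondPiece (δ := δ) hij h0 h1 (true, true)
    exact ⟨x, interior_maximal subset_closure isOpen_diamond hx.1⟩
  · exact ((isPerturbation_diamondBump hij h0 h1 hδ).clm_comp
      ((ContinuousLinearMap.id ℝ ℝ).smulRight a)).add (IsPerturbation.sum _ fun σ _ => hw σ)
  · refine closure_mono fun x hx => ?_
    by_contra h
    refine hx ?_
    beta_reduce
    rw [diamondBump_eq_zero h, Finset.sum_eq_zero]
    · simp
    · exact fun σ _ => image_eq_zero_of_notMem_tsupport fun h' => h (hsupp σ h').1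
  · rw [excess_diamondBump_add hF A a hij h0 h1 hδ hw hsupp]
    have hS := sum_volume_diamondPiece (δ := δ) hij h0 h1 hδ
    have hM := sum_tentSlope_mul_volume (δ := δ) hij h0 h1 hδ
    -- Written this way, the target energy is its mean plus a multiple of the slope, and the slope
    -- term integrates to zero by `hM`.
    have hT' : ∀ b, T b = l * s + (1 - l) * t + (s - t) * tentSlope l b := by
      intro b
      cases b <;> simp only [hT, tentSlope, Bool.false_eq_true, if_true, if_false] <;> ring
    calc _ < ∑ σ : Bool × Bool, (T σ.1 - F A) * volume.real (diamondPiece i j l δ σ) := by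
          refine Finset.sum_lt_sum_of_nonempty Finset.univ_nonempty fun σ _ => ?_
          have := hlt σ
          linarith
      _ = (l * s + (1 - l) * t - F A) * ∑ σ, volume.real (diamondPiece i j l δ σ) +
          (s - t) * ∑ σ : Bool × Bool,
            tentSlope l σ.1 * volume.real (diamondPiece i j l δ σ) := by
          rw [Finset.mul_sum, Finset.mul_sum, ← Finset.sum_add_distrib]
          refine Finset.sum_congr rfl fun σ _ => ?_
          rw [hT']; ring
      _ = _ := by rw [hS, hM]; ring

end RankOne

/-! ### The threshold exponent and the contraction rate of the staircase. -/

section Threshold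

theorem bddAbove_thresholdExponent {p : ℝ} (hp : 1 < p) :
    BddAbove ((fun b : ℝ => (p - 1) / (b ^ (p - 1) + 1) + b / (b + 1)) '' Ioi 0) := by
  refine ⟨(p - 1) + 1, ?_⟩
  rintro _ ⟨b, hb, rfl⟩
  have hb : 0 < b := hb
  have h1 : 0 < b ^ (p - 1) := Real.rpow_pos_of_pos hb _
  refine add_le_add (div_le_self (by linarith) (by linarith)) ?_
  rw [div_le_one (by linarith)]; linarith

/-- For `p < 2` let `b` be large: the loss `1/(b+1)` from the limit `1` is smaller than the gain, of
order `b^{-(p-1)}`. For `p > 2` let `b` be small: the gain, of order `b`, beats the loss from `p-1`,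
of order `b^{p-1}`. -/
theorem max_lt_thresholdExponent {p : ℝ} (hp : 1 < p) (hp2 : p ≠ 2) :
    max (p - 1) 1 < thresholdExponent p := by
  suffices ∃ b : ℝ, 0 < b ∧ max (p - 1) 1 < (p - 1) / (b ^ (p - 1) + 1) + b / (b + 1) by
    obtain ⟨b, hb, h⟩ := this
    exact h.trans_le (le_csSup (bddAbove_thresholdExponent hp) ⟨b, hb, rfl⟩)
  have hp1 : 0 < p - 1 := by linarith
  rcases lt_or_gt_of_ne hp2 with h | h
  · rw [max_eq_right (by linarith)]
    obtain ⟨b, hb, hb1⟩ := (((tendsto_rpow_atTop (sub_pos.2 h)).eventually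
      (eventually_gt_atTop (2 / (p - 1)))).and (eventually_ge_atTop 1)).exists
    have hb0 : 0 < b := by linarith
    refine ⟨b, hb0, ?_⟩
    have hmul : b ^ (2 - p) * b ^ (p - 1) = b := by
      rw [← Real.rpow_add hb0, sub_add_sub_cancel]; norm_num
    have hc : 1 ≤ b ^ (p - 1) := Real.one_le_rpow hb1 hp1.le
    have hkey : 2 * b ^ (p - 1) < (p - 1) * b := by
      rw [div_lt_iff₀ hp1] at hb
      calc 2 * b ^ (p - 1) < b ^ (2 - p) * (p - 1) * b ^ (p - 1) := by gcongr
        _ = (p - 1) * b := by linear_combination (p - 1) * hmul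
    have h2 : 1 - b / (b + 1) = 1 / (b + 1) := by field_simp; ring
    have h3 : 1 / (b + 1) < (p - 1) / (b ^ (p - 1) + 1) := by
      rw [div_lt_div_iff₀ (by linarith) (by linarith)]
      nlinarith
    linarith
  · rw [max_eq_left (by linarith)]
    have hlim : Tendsto (fun b : ℝ => b ^ (p - 2)) (𝓝[>] 0) (𝓝 0) := by
      have := (Real.continuousAt_rpow_const 0 (p - 2) (Or.inr (by linarith))).tendsto
      rw [Real.zero_rpow (by linarith)] at this
      exact this.mono_left nhdsWithin_le_nhds
    have hpos : 0 < 1 / (2 * (p - 1)) := by positivity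
    obtain ⟨b, hb, hb0, hb1⟩ :=
      ((hlim.eventually (gt_mem_nhds hpos)).and (Ioo_mem_nhdsGT one_pos)).exists
    refine ⟨b, hb0, ?_⟩
    have hc : 0 < b ^ (p - 1) := Real.rpow_pos_of_pos hb0 _
    have hmul : b ^ (p - 1) = b ^ (p - 2) * b := by
      rw [← Real.rpow_add_one hb0.ne']; congr 1; ring
    have hkey : 2 * (p - 1) * b ^ (p - 1) < b := by
      rw [lt_div_iff₀ (by positivity)] at hb
      rw [hmul]; nlinarith
    have h2 : (p - 1) - (p - 1) / (b ^ (p - 1) + 1) ≤ (p - 1) * b ^ (p - 1) := by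
      rw [sub_le_iff_le_add, ← sub_le_iff_le_add', le_div_iff₀ (by linarith)]
      nlinarith [mul_pos hp1 (mul_pos hc hc)]
    have h3 : b / 2 ≤ b / (b + 1) := by gcongr; linarith
    linarith

theorem exists_of_lt_thresholdExponent {p r : ℝ} (h : r < thresholdExponent p) :
    ∃ b : ℝ, 0 < b ∧ r < 1 / (1 + b) + (p - 1) * b ^ (p - 1) / (1 + b ^ (p - 1)) := by
  obtain ⟨_, ⟨b, hb, rfl⟩, hlt⟩ := exists_lt_of_lt_csSup ((nonempty_Ioi (a := (0 : ℝ))).image _) h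
  have hb : 0 < b := hb
  -- Inverting `b` turns the expression of the threshold into the rate at which the staircase loses
  -- mass.
  refine ⟨b⁻¹, inv_pos.2 hb, hlt.trans_eq ?_⟩
  have hc : 0 < b ^ (p - 1) := Real.rpow_pos_of_pos hb _
  rw [Real.inv_rpow hb.le, add_comm]
  field_simp

/-- Climbing from height `1` to height `θ` slightly above `1` contracts the normalised energy. -/
theorem exists_contracting_ratio {p r b β : ℝ} (hb : 0 < b) (hβ : 0 < β)
    (h : r < 1 / (1 + b) + (p - 1) * β / (1 + β)) :
    ∃ θ : ℝ, 1 < θ ∧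
      (1 + b) / (θ + b) * ((1 + β * θ ^ (1 - p)) / (1 + β)) * θ ^ r < 1 := by
  set f : ℝ → ℝ := fun θ => (1 + b) / (θ + b) * ((1 + β * θ ^ (1 - p)) / (1 + β)) * θ ^ r with hf
  have hf1 : f 1 = 1 := by
    simp only [hf, Real.one_rpow, mul_one]
    rw [div_self (by positivity), div_self (by positivity), one_mul]
  -- As `f 1 = 1`, a negative derivative there yields `θ > 1` with `f θ < 1`.
  have hd : HasDerivAt f (r - (1 / (1 + b) + (p - 1) * β / (1 + β))) 1 := by
    have h1 : HasDerivAt (fun θ : ℝ => (1 + b) / (θ + b)) (-(1 + b) / (1 + b) ^ 2) 1 := by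
      have := (hasDerivAt_const (1 : ℝ) (1 + b)).div ((hasDerivAt_id (1 : ℝ)).add_const b)
        (by simp only [id]; positivity)
      simpa [Pi.div_def] using this
    have h2 : HasDerivAt (fun θ : ℝ => (1 + β * θ ^ (1 - p)) / (1 + β))
        (β * (1 - p) / (1 + β)) 1 := by
      have := (((Real.hasDerivAt_rpow_const (x := 1) (p := 1 - p) (Or.inl one_ne_zero)).const_mul
        β).const_add 1).div_const (1 + β)
      simpa using this
    have h3 : HasDerivAt (fun θ : ℝ => θ ^ r) r 1 := by
      simpa using Real.hasDerivAt_rpow_const (x := 1) (p := r) (Or.inl one_ne_zero)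
    refine ((h1.mul h2).mul h3).congr_deriv ?_
    rw [Pi.mul_apply]
    simp only [Real.one_rpow, mul_one]
    field_simp
    ring
  have hslope := (hasDerivAt_iff_tendsto_slope.1 hd).mono_left
    (nhdsWithin_mono (1 : ℝ) fun x (hx : x ∈ Ioi 1) => ne_of_gt hx)
  obtain ⟨θ, hθ, hθ1⟩ :=
    ((hslope.eventually (gt_mem_nhds (sub_neg.2 h))).and self_mem_nhdsWithin).exists
  have hθ1 : 1 < θ := hθ1
  refine ⟨θ, hθ1, ?_⟩
  rw [slope_def_field, hf1, div_lt_iff₀ (sub_pos.2 hθ1), zero_mul] at hθ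
  linarith

end Threshold

/-! ### The staircase, for an abstract relation closed under horizontal and vertical mixing. -/

section Staircase

variable {S : ℝ → ℝ → ℝ → Prop} {p r β : ℝ}

/-- One step of the staircase: two successive splittings along the coordinate directions. -/
theorem staircase_step {b θ τ : ℝ} (hp : 1 < p) (hb : 0 < b) (hβ : β = b ^ (p - 1)) (hθ : 1 < θ)
    (hhor : ∀ {x₁ x₂ y s t l}, 0 < l → l < 1 → S x₁ y s → S x₂ y t →
      S (l * x₁ + (1 - l) * x₂) y (l * s + (1 - l) * t))
    (hver : ∀ {x y₁ y₂ s t l}, 0 < l → l < 1 → S x y₁ s → S x y₂ t →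
      S x (l * y₁ + (1 - l) * y₂) (l * s + (1 - l) * t))
    (hneg : ∀ {x y t}, S x y t → S (-x) (-y) t)
    (hcurve : ∀ {x t}, 0 < x → -x ^ r < t → S x (x ^ (p - 1)) t)
    (hτ : ∀ x, 0 < x → S x (-(β * x ^ (p - 1))) (τ * x ^ r)) (x : ℝ) (hx : 0 < x) :
    S x (-(β * x ^ (p - 1)))
      (((1 + b) / (θ + b) * ((1 + β * θ ^ (1 - p)) / (1 + β)) * θ ^ r * τ -
        (θ - 1) / (θ + b) * (b ^ r / 2)) * x ^ r) := by
  have hθ0 : 0 < θ := by linarith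
  have hβ0 : 0 < β := hβ ▸ Real.rpow_pos_of_pos hb _
  have hX : 0 < θ * x := mul_pos hθ0 hx
  have hpow : ∀ {z : ℝ} (q : ℝ), 0 < z → 0 < z ^ q := fun q hz => Real.rpow_pos_of_pos hz q
  have hθp : θ ^ (1 - p) < 1 := Real.rpow_lt_one_of_one_lt_of_neg hθ (by linarith)
  have hθp0 := hpow (1 - p) hθ0
  have hθmul : θ ^ (1 - p) * θ ^ (p - 1) = 1 := by rw [← Real.rpow_add hθ0]; simp
  set l₁ := (1 + b) / (θ + b) with hl₁
  set l₂ := (1 + β * θ ^ (1 - p)) / (1 + β) with hl₂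
  have hl₁0 : 0 < l₁ := by positivity
  have hl₁1 : l₁ < 1 := by rw [hl₁, div_lt_one (by positivity)]; linarith
  have hl₂0 : 0 < l₂ := by positivity
  have hl₂1 : l₂ < 1 := by rw [hl₂, div_lt_one (by positivity)]; nlinarith
  -- The weight `l₂` is chosen so that the mixture has ordinate `-βx^{p-1}`. The crude value `0` for
  -- the curve point is enough here.
  have hv := hver hl₂0 hl₂1 (hτ _ hX) (hcurve (t := 0) hX (by have := hpow r hX; linarith))
  have hvy : l₂ * -(β * (θ * x) ^ (p - 1)) + (1 - l₂) * (θ * x) ^ (p - 1) =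
      -(β * x ^ (p - 1)) := by
    rw [Real.mul_rpow hθ0.le hx.le, hl₂]
    field_simp
    linear_combination (-β - β ^ 2) * hθmul
  rw [hvy] at hv
  have hbx : 0 < b * x := mul_pos hb hx
  -- The left endpoint is the reflection of the curve point over `bx`. This is the source of the
  -- gain; only half of it is kept, since `hcurve` requires a value strictly above `-(bx)^r`.
  have hk := hneg (hcurve (t := -(b * x) ^ r / 2) hbx (by have := hpow r hbx; linarith))
  rw [Real.mul_rpow hb.le hx.le, ← hβ] at hk
  have hh := hhor hl₁0 hl₁1 hv hk
  have hhx : l₁ * (θ * x) + (1 - l₁) * -(b * x) = x := by rw [hl₁]; field_simp; ring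
  have hl₁' : (θ - 1) / (θ + b) = 1 - l₁ := by rw [hl₁]; field_simp; ring
  rw [hhx] at hh
  convert hh using 1
  rw [Real.mul_rpow hθ0.le hx.le, Real.mul_rpow hb.le hx.le, hl₁']
  ring

/-- The staircase brings the origin down to negative energy, provided that the exponent is below
the decay rate of the staircase. -/
theorem staircase {b M : ℝ} (hp : 1 < p) (hb : 0 < b) (hβ : β = b ^ (p - 1))
    (hr : r < 1 / (1 + b) + (p - 1) * β / (1 + β))
    (hmono : ∀ {x y s t}, S x y s → s ≤ t → S x y t)
    (hhor : ∀ {x₁ x₂ y s t l}, 0 < l → l < 1 → S x₁ y s → S x₂ y t →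
      S (l * x₁ + (1 - l) * x₂) y (l * s + (1 - l) * t))
    (hver : ∀ {x y₁ y₂ s t l}, 0 < l → l < 1 → S x y₁ s → S x y₂ t →
      S x (l * y₁ + (1 - l) * y₂) (l * s + (1 - l) * t))
    (hneg : ∀ {x y t}, S x y t → S (-x) (-y) t)
    (hcurve : ∀ {x t}, 0 < x → -x ^ r < t → S x (x ^ (p - 1)) t)
    (hM : ∀ x, 0 < x → S x (-(β * x ^ (p - 1))) (M * x ^ r)) : S 0 0 0 := by
  have hβ0 : 0 < β := hβ ▸ Real.rpow_pos_of_pos hb _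
  obtain ⟨θ, hθ, hμ1⟩ := exists_contracting_ratio hb hβ0 hr
  have hstep := fun τ => staircase_step (τ := τ) hp hb hβ hθ hhor hver hneg hcurve
  set μ := (1 + b) / (θ + b) * ((1 + β * θ ^ (1 - p)) / (1 + β)) * θ ^ r with hμ
  set c := (θ - 1) / (θ + b) * (b ^ r / 2) with hc
  have hθ0 : 0 < θ := by linarith
  have hμ0 : 0 ≤ μ := by
    have := Real.rpow_pos_of_pos hθ0 (1 - p)
    have := Real.rpow_pos_of_pos hθ0 r
    positivity
  have hc0 : 0 < c := by
    have := Real.rpow_pos_of_pos hb r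
    have := sub_pos.2 hθ
    positivity
  -- `-e` is the fixed point of the recursion `τ ↦ μ τ - c`, which gives the closed form in `hiter`.
  set e := c / (1 - μ) with he
  have he0 : 0 < e := div_pos hc0 (sub_pos.2 hμ1)
  have hec : e * (1 - μ) = c := div_mul_cancel₀ _ (sub_pos.2 hμ1).ne'
  have hiter : ∀ k : ℕ, ∀ x, 0 < x →
      S x (-(β * x ^ (p - 1))) ((μ ^ k * (M + e) - e) * x ^ r) := by
    intro k
    induction k with
    | zero => simpa using hM
    | succ k ih =>
      intro x hx
      convert hstep _ ih x hx using 2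
      rw [← hec]; ring
  have hlim : Tendsto (fun k : ℕ => μ ^ k * (M + e)) atTop (𝓝 0) := by
    simpa using (tendsto_pow_atTop_nhds_zero_of_lt_one hμ0 hμ1).mul_const (M + e)
  obtain ⟨k, hk⟩ := (hlim.eventually (gt_mem_nhds he0)).exists
  have h1 := hiter k 1 one_pos
  simp only [Real.one_rpow, mul_one] at h1
  -- Mixing `(1, -β)` with `(1, 1)` gives `(1, 0)`; mixing that with its reflection `(-1, 0)` gives
  -- the origin.
  have h2 : S 1 1 0 := by simpa using hcurve (x := 1) (t := 0) one_pos (by simp)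
  have hl0 : 0 < 1 / (1 + β) := by positivity
  have hl1 : 1 / (1 + β) < 1 := by rw [div_lt_one (by positivity)]; linarith
  have h3 := hver hl0 hl1 h1 h2
  have h4 : 1 / (1 + β) * -β + (1 - 1 / (1 + β)) * 1 = 0 := by field_simp; ring
  rw [h4] at h3
  have h5 := hneg h3
  rw [neg_zero] at h5
  have h6 := hhor (l := 1 / 2) (by norm_num) (by norm_num) h3 h5
  have h7 : (1 / 2 : ℝ) * 1 + (1 - 1 / 2) * -1 = 0 := by norm_num
  rw [h7] at h6
  refine hmono h6 ?_
  have := mul_pos hl0 (sub_pos.2 hk)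
  linarith

end Staircase

/-! ### The defect energy on diagonal states, and the staircase for it. -/

section Energy

theorem norm_pFlux {n : ℕ} {p : ℝ} (hp : 1 < p) (ξ : Eucl n) : ‖pFlux p ξ‖ = ‖ξ‖ ^ (p - 1) := by
  rw [pFlux, norm_smul, Real.norm_of_nonneg (Real.rpow_nonneg (norm_nonneg _) _)]
  rcases (norm_nonneg ξ).eq_or_lt with h | h
  · rw [← h, mul_zero, Real.zero_rpow (by linarith)]
  · rw [← Real.rpow_add_one h.ne']; congr 1; ring

theorem continuous_pFlux {n : ℕ} {p : ℝ} (hp : 1 < p) : Continuous (pFlux (n := n) p) := by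
  rw [continuous_iff_continuousAt]
  intro ξ
  by_cases hξ : ξ = 0
  · rw [hξ, ContinuousAt]
    have h0 : pFlux p (0 : Eucl n) = 0 := by simp [pFlux]
    rw [h0, tendsto_zero_iff_norm_tendsto_zero]
    simp only [norm_pFlux hp]
    refine Continuous.tendsto' (continuous_norm.rpow_const fun _ => Or.inr (by linarith)) _ _ ?_
    rw [norm_zero, Real.zero_rpow (by linarith)]
  · exact (continuous_norm.continuousAt.rpow_const (Or.inl (norm_ne_zero_iff.2 hξ))).smul
      continuousAt_id

theorem pFlux_neg {n : ℕ} (p : ℝ) (ξ : Eucl n) : pFlux p (-ξ) = -pFlux p ξ := by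
  simp [pFlux]

/-- The rotation by a right angle in the plane. -/
noncomputable def perp (η : Eucl 2) : Eucl 2 := !₂[-(η 1), η 0]

theorem continuous_perp : Continuous perp := by
  unfold perp
  refine (PiLp.continuous_toLp 2 _).comp (continuous_pi fun k => ?_)
  fin_cases k <;> simp <;> fun_prop

theorem perp_neg (η : Eucl 2) : perp (-η) = -perp η := by
  ext k; fin_cases k <;> simp [perp]

/-- The vector representing a linear form. -/
noncomputable def gradForm {n : ℕ} (L : Eucl n →L[ℝ] ℝ) : Eucl n :=
  (InnerProductSpace.toDual ℝ (Eucl n)).symm L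

theorem continuous_gradForm {n : ℕ} : Continuous (gradForm (n := n)) :=
  (InnerProductSpace.toDual ℝ (Eucl n)).symm.continuous

theorem gradForm_neg {n : ℕ} (L : Eucl n →L[ℝ] ℝ) : gradForm (-L) = -gradForm L :=
  map_neg _ L

theorem inner_gradForm {n : ℕ} (L : Eucl n →L[ℝ] ℝ) (x : Eucl n) : inner ℝ (gradForm L) x = L x :=
  InnerProductSpace.toDual_symm_apply

theorem gradForm_smul_proj {n : ℕ} (c : ℝ) (i : Fin n) :
    gradForm (c • (EuclideanSpace.proj i : Eucl n →L[ℝ] ℝ)) = EuclideanSpace.single i c := by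
  refine ext_inner_right ℝ fun x => ?_
  rw [inner_gradForm, EuclideanSpace.inner_single_left]
  simp

/-- The energy density `Λ ||ξ|^{p-2} ξ - η^⊥|^s - |ξ|^r` of a pair of gradients `(ξ, η)`. -/
noncomputable def defectEnergy (p r s Λ : ℝ) (L : Eucl 2 →L[ℝ] ℝ × ℝ) : ℝ :=
  Λ * ‖pFlux p (gradForm ((ContinuousLinearMap.fst ℝ ℝ ℝ).comp L)) -
    perp (gradForm ((ContinuousLinearMap.snd ℝ ℝ ℝ).comp L))‖ ^ s -
    ‖gradForm ((ContinuousLinearMap.fst ℝ ℝ ℝ).comp L)‖ ^ r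

theorem continuous_defectEnergy {p r s Λ : ℝ} (hp : 1 < p) (hr : 0 ≤ r) (hs : 0 ≤ s) :
    Continuous (defectEnergy p r s Λ) := by
  have h1 : Continuous fun L : Eucl 2 →L[ℝ] ℝ × ℝ =>
      gradForm ((ContinuousLinearMap.fst ℝ ℝ ℝ).comp L) := continuous_gradForm.comp (by fun_prop)
  have h2 : Continuous fun L : Eucl 2 →L[ℝ] ℝ × ℝ =>
      gradForm ((ContinuousLinearMap.snd ℝ ℝ ℝ).comp L) := continuous_gradForm.comp (by fun_prop)
  exact (continuous_const.mul ((((continuous_pFlux hp).comp h1).sub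
    (continuous_perp.comp h2)).norm.rpow_const fun _ => Or.inr hs)).sub
    (h1.norm.rpow_const fun _ => Or.inr hr)

theorem defectEnergy_neg (p r s Λ : ℝ) (L : Eucl 2 →L[ℝ] ℝ × ℝ) :
    defectEnergy p r s Λ (-L) = defectEnergy p r s Λ L := by
  unfold defectEnergy
  rw [ContinuousLinearMap.comp_neg, ContinuousLinearMap.comp_neg, gradForm_neg, gradForm_neg,
    pFlux_neg, perp_neg, neg_sub_neg, norm_neg, norm_sub_rev]

/-- The pair of gradients `∇u = (x, 0)`, `∇^⊥ v = (y, 0)`. -/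
noncomputable def diagonalPair (x y : ℝ) : Eucl 2 →L[ℝ] ℝ × ℝ :=
  (x • (EuclideanSpace.proj 0 : Eucl 2 →L[ℝ] ℝ)).prod
    ((-y) • (EuclideanSpace.proj 1 : Eucl 2 →L[ℝ] ℝ))

theorem defectEnergy_diagonalPair (p r s Λ x y : ℝ) :
    defectEnergy p r s Λ (diagonalPair x y) = Λ * |(|x| ^ (p - 2) * x - y)| ^ s - |x| ^ r := by
  unfold defectEnergy diagonalPair
  rw [ContinuousLinearMap.fst_comp_prod, ContinuousLinearMap.snd_comp_prod, gradForm_smul_proj,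
    gradForm_smul_proj]
  have h1 : pFlux p (EuclideanSpace.single (0 : Fin 2) x) - perp (EuclideanSpace.single 1 (-y)) =
      EuclideanSpace.single (0 : Fin 2) (|x| ^ (p - 2) * x - y) := by
    ext k; fin_cases k <;> simp [pFlux, perp]
  rw [h1]
  simp

theorem diagonalPair_convex_left (x₁ x₂ y l : ℝ) :
    l • diagonalPair x₁ y + (1 - l) • diagonalPair x₂ y =
      diagonalPair (l * x₁ + (1 - l) * x₂) y := by
  ext x
  · simp [diagonalPair]; ring
  · simp [diagonalPair]; ring

theorem diagonalPair_convex_right (x y₁ y₂ l : ℝ) :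
    l • diagonalPair x y₁ + (1 - l) • diagonalPair x y₂ =
      diagonalPair x (l * y₁ + (1 - l) * y₂) := by
  ext x
  · simp [diagonalPair]; ring
  · simp [diagonalPair]; ring

/-- Below the threshold exponent, the defect energy can be made negative starting from the zero
gradient. -/
theorem relaxes_defectEnergy {p r Λ : ℝ} (hp : 1 < p) (hr : 0 < r)
    (hlt : r < thresholdExponent p) :
    Relaxes (defectEnergy p r (r / (p - 1)) Λ) 0 0 := by
  obtain ⟨b, hb, hlt⟩ := exists_of_lt_thresholdExponent hlt
  have hp1 : 0 < p - 1 := by linarith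
  have hs : 0 < r / (p - 1) := div_pos hr hp1
  set F := defectEnergy p r (r / (p - 1)) Λ with hFdef
  have hF : Continuous F := continuous_defectEnergy hp hr.le hs.le
  have hflux : ∀ {x : ℝ}, 0 < x → |x| ^ (p - 2) * x = x ^ (p - 1) := by
    intro x hx
    rw [abs_of_pos hx, ← Real.rpow_add_one hx.ne']; congr 1; ring
  have hzero : (0 : Eucl 2 →L[ℝ] ℝ × ℝ) = diagonalPair 0 0 := by
    ext x <;> simp [diagonalPair]
  rw [hzero]
  -- At `(x, -βx^{p-1})` the defect is `(1+β)x^{p-1}`, whose power `r/(p-1)` is a multiple of `x^r`;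
  -- this gives `M` as the initial cost, with no perturbation at all.
  refine staircase (S := fun x y t => Relaxes F (diagonalPair x y) t)
    (M := Λ * (1 + b ^ (p - 1)) ^ (r / (p - 1))) hp hb rfl hlt
    (fun h hst => h.mono hst) ?_ ?_ ?_ ?_ ?_
  · intro x₁ x₂ y s t l h0 h1 hs ht
    rw [← diagonalPair_convex_left]
    refine Relaxes.rankOne hF 0 (a := (x₁ - x₂, 0)) ?_ h0 h1 hs ht
    ext x
    · simp [diagonalPair]; ring
    · simp [diagonalPair]
  · intro x y₁ y₂ s t l h0 h1 hs ht
    rw [← diagonalPair_convex_right]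
    refine Relaxes.rankOne hF 1 (a := (0, y₂ - y₁)) ?_ h0 h1 hs ht
    ext x
    · simp [diagonalPair]
    · simp [diagonalPair]; ring
  · intro x y t h
    have h1 : diagonalPair (-x) (-y) = -diagonalPair x y := by
      ext x <;> simp [diagonalPair]
    rw [h1]
    exact h.neg (defectEnergy_neg p r _ Λ)
  · intro x t hx ht
    refine Relaxes.of_lt ?_
    rw [hFdef, defectEnergy_diagonalPair, hflux hx, sub_self, abs_zero, Real.zero_rpow hs.ne',
      abs_of_pos hx]
    linarith
  · intro x hx
    refine Relaxes.of_lt ?_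
    have hxp := Real.rpow_pos_of_pos hx (p - 1)
    have hbp := Real.rpow_pos_of_pos hb (p - 1)
    have h1 : x ^ (p - 1) - -(b ^ (p - 1) * x ^ (p - 1)) = (1 + b ^ (p - 1)) * x ^ (p - 1) := by
      ring
    rw [hFdef, defectEnergy_diagonalPair, hflux hx, h1, abs_of_pos (by positivity),
      abs_of_pos hx, Real.mul_rpow (by positivity) hxp.le, ← Real.rpow_mul hx.le,
      mul_div_cancel₀ _ hp1.ne']
    have := Real.rpow_pos_of_pos hx r
    linarith

end Energy

/-! ### Smooth approximation of perturbations. -/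

section Mollification

variable {n : ℕ}

/-- A smooth bump function with support the ball of radius `ε`. -/
noncomputable def bumpOfRadius (n : ℕ) {ε : ℝ} (hε : 0 < ε) : ContDiffBump (0 : Eucl n) where
  rIn := ε / 2
  rOut := ε
  rIn_pos := half_pos hε
  rIn_lt_rOut := half_lt_self hε

/-- The mollification of `u` at scale `ε`. -/
noncomputable def mollify {ε : ℝ} (hε : 0 < ε) (u : Eucl n → ℝ) : Eucl n → ℝ :=
  convolution ((bumpOfRadius n hε).normed volume) u (ContinuousLinearMap.lsmul ℝ ℝ) volume

theorem contDiff_mollify {ε : ℝ} (hε : 0 < ε) {u : Eucl n → ℝ} (hu : Continuous u) :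
    ContDiff ℝ ∞ (mollify hε u) :=
  (bumpOfRadius n hε).hasCompactSupport_normed.contDiff_convolution_left _
    (bumpOfRadius n hε).contDiff_normed hu.locallyIntegrable

theorem abs_mollify_sub_sub_le {ε : ℝ} (hε : 0 < ε) {u : Eucl n → ℝ} (hu : Continuous u)
    {x y : Eucl n} {c M : ℝ}
    (h : ∀ t ∈ Metric.ball (0 : Eucl n) ε, |u (y - t) - u (x - t) - c| ≤ M) :
    |mollify hε u y - mollify hε u x - c| ≤ M := by
  set ψ := (bumpOfRadius n hε).normed volume with hψ
  have hψc : Continuous ψ := (bumpOfRadius n hε).continuous_normed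
  have hψs : HasCompactSupport ψ := (bumpOfRadius n hε).hasCompactSupport_normed
  have hψi : ∫ t, ψ t = 1 := (bumpOfRadius n hε).integral_normed
  have hint : ∀ g : Eucl n → ℝ, Continuous g → Integrable fun t => ψ t * g t := fun g hg =>
    (hψc.mul hg).integrable_of_hasCompactSupport hψs.mul_right
  have heq : mollify hε u y - mollify hε u x - c = ∫ t, ψ t * (u (y - t) - u (x - t) - c) := by
    have h1 := hint (fun t => u (y - t)) (by fun_prop)
    have h2 := hint (fun t => u (x - t)) (by fun_prop)
    have h3 := hint (fun _ => c) (by fun_prop)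
    have h4 := integral_sub (h1.sub h2) h3
    simp only [Pi.sub_apply] at h4
    simp only [mul_sub]
    rw [h4, integral_sub h1 h2, integral_mul_const, hψi, one_mul]
    rfl
  rw [heq, ← Real.norm_eq_abs]
  calc _ ≤ ∫ t, ψ t * M := by
        refine norm_integral_le_of_norm_le (hint (fun _ => M) (by fun_prop))
          (Eventually.of_forall fun t => ?_)
        have hψ0 : 0 ≤ ψ t := (bumpOfRadius n hε).nonneg_normed t
        rw [norm_mul, Real.norm_of_nonneg hψ0, Real.norm_eq_abs]
        by_cases ht : t ∈ Metric.ball (0 : Eucl n) ε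
        · exact mul_le_mul_of_nonneg_left (h t ht) hψ0
        · have : ψ t = 0 := by
            rw [← Function.notMem_support, hψ, ContDiffBump.support_normed_eq]
            exact ht
          simp [this]
    _ = M := by rw [integral_mul_const, hψi, one_mul]

theorem lipschitzWith_mollify {ε : ℝ} (hε : 0 < ε) {u : Eucl n → ℝ} {K : NNReal}
    (hu : LipschitzWith K u) : LipschitzWith K (mollify hε u) := by
  refine LipschitzWith.of_dist_le_mul fun y x => ?_
  have := abs_mollify_sub_sub_le hε hu.continuous (x := x) (y := y) (c := 0)
    (M := K * dist y x) fun t _ => ?_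
  · simpa [Real.dist_eq] using this
  · have := hu.dist_le_mul (y - t) (x - t)
    rw [dist_sub_right, Real.dist_eq] at this
    simpa using this

theorem dist_mollify_le {ε : ℝ} (hε : 0 < ε) {u : Eucl n → ℝ} {K : NNReal}
    (hu : LipschitzWith K u) (x : Eucl n) : dist (mollify hε u x) (u x) ≤ K * ε := by
  refine ContDiffBump.dist_normed_convolution_le hu.continuous.aestronglyMeasurable
    fun y hy => (hu.dist_le_mul y x).trans ?_
  gcongr
  exact (Metric.mem_ball.1 hy).le

theorem tsupport_mollify_subset {ε : ℝ} (hε : 0 < ε) (u : Eucl n → ℝ) :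
    tsupport (mollify hε u) ⊆ Metric.cthickening ε (tsupport u) := by
  refine closure_minimal (fun x hx => ?_) Metric.isClosed_cthickening
  obtain ⟨y, hy, z, hz, rfl⟩ := support_convolution_subset_swap _ hx
  rw [ContDiffBump.support_normed_eq] at hz
  refine Metric.mem_cthickening_of_dist_le _ y ε _ (subset_tsupport u hy) ?_
  have : ‖z‖ < ε := mem_ball_zero_iff.1 hz
  simpa [dist_eq_norm] using this.le

/-- Averaging translates of an affine function only adds a constant, so the derivative is reproduced
exactly. Pointwise convergence of gradients at locally affine points is then immediate. -/
theorem fderiv_mollify {ε : ℝ} (hε : 0 < ε) {u : Eucl n → ℝ} (hu : Continuous u) {x : Eucl n}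
    {L : Eucl n →L[ℝ] ℝ} (h : ∀ z ∈ Metric.ball x (2 * ε), u z = u x + L (z - x)) :
    fderiv ℝ (mollify hε u) x = L := by
  refine (LocallyAffineAt.hasFDerivAt ?_).fderiv
  filter_upwards [Metric.ball_mem_nhds x hε] with y hy
  have := abs_mollify_sub_sub_le hε hu (x := x) (y := y) (c := L (y - x)) (M := 0) fun t ht => ?_
  · have := abs_eq_zero.1 (le_antisymm this (abs_nonneg _))
    linarith
  · have ht : ‖t‖ < ε := mem_ball_zero_iff.1 ht
    have hy : ‖y - x‖ < ε := mem_ball_iff_norm.1 hy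
    have h1 : y - t ∈ Metric.ball x (2 * ε) := by
      rw [mem_ball_iff_norm, sub_right_comm]
      linarith [norm_sub_le (y - x) t]
    have h2 : x - t ∈ Metric.ball x (2 * ε) := by
      rw [mem_ball_iff_norm, sub_sub_cancel_left, norm_neg]
      linarith
    rw [h _ h1, h _ h2, sub_right_comm y t x, sub_sub_cancel_left, map_sub, map_neg]
    simp

/-- Mollifications of `u` converge to `u`, and their derivatives are eventually exact at the points
where `u` is locally affine. -/
theorem IsPerturbation.exists_testFunction {u : Eucl n → ℝ} (hu : IsPerturbation u) {K : NNReal}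
    (hK : LipschitzWith K u) {Ω : Set (Eucl n)} (hΩ : IsOpen Ω) (hs : tsupport u ⊆ Ω) :
    ∃ φ : ℕ → Eucl n → ℝ, (∀ k, IsTestFunction Ω (φ k)) ∧ (∀ k, LipschitzWith K (φ k)) ∧
      (∃ M, ∀ k x, ‖φ k x‖ ≤ M) ∧ (∀ x, Tendsto (fun k => φ k x) atTop (𝓝 (u x))) ∧
      ∀ x, LocallyAffineAt u x → ∀ᶠ k in atTop, gradient (φ k) x = gradient u x := by
  obtain ⟨δ, hδ, hδΩ⟩ := hu.compact.isCompact.exists_cthickening_subset_open hΩ hs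
  set ε : ℕ → ℝ := fun k => δ / (k + 1) with hεdef
  have hε : ∀ k, 0 < ε k := fun k => by positivity
  have hεδ : ∀ k, ε k ≤ δ := fun k => div_le_self hδ.le (by simp)
  have hlim : Tendsto ε atTop (𝓝 0) := by
    simpa [hεdef, div_eq_mul_inv] using tendsto_one_div_add_atTop_nhds_zero_nat.const_mul δ
  have hsub : ∀ k, tsupport (mollify (hε k) u) ⊆ Metric.cthickening δ (tsupport u) := fun k =>
    (tsupport_mollify_subset (hε k) u).trans (Metric.cthickening_mono (hεδ k) _)
  obtain ⟨M, hM⟩ := hu.compact.exists_bound_of_continuous hK.continuous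
  refine ⟨fun k => mollify (hε k) u, fun k => ⟨contDiff_mollify (hε k) hK.continuous, ?_,
    (hsub k).trans hδΩ⟩, fun k => lipschitzWith_mollify (hε k) hK, ⟨M + K * δ, fun k x => ?_⟩,
    fun x => ?_, fun x hx => ?_⟩
  · exact hu.compact.isCompact.cthickening.of_isClosed_subset (isClosed_tsupport _) (hsub k)
  · have h1 : ‖mollify (hε k) u x - u x‖ ≤ K * ε k := dist_eq_norm _ (u x) ▸
      dist_mollify_le (hε k) hK x
    have h2 : (K : ℝ) * ε k ≤ K * δ := by gcongr; exact hεδ k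
    have h3 := norm_le_norm_add_norm_sub' (mollify (hε k) u x) (u x)
    linarith [hM x]
  · rw [tendsto_iff_dist_tendsto_zero]
    refine squeeze_zero (fun _ => dist_nonneg) (fun k => dist_mollify_le (hε k) hK x) ?_
    simpa using hlim.const_mul (K : ℝ)
  · obtain ⟨ρ, hρ, hball⟩ := Metric.eventually_nhds_iff_ball.1 hx.eventually_eq
    filter_upwards [hlim.eventually (gt_mem_nhds (half_pos hρ))] with k hk
    rw [gradient, gradient, fderiv_mollify (hε k) hK.continuous fun z hz =>
      hball z (Metric.ball_subset_ball (by linarith) hz)]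

end Mollification

/-! ### Perturbations as Sobolev functions and as piecewise affine functions. -/

section Sobolev

variable {n : ℕ}

theorem tendsto_eLpNorm_sub_of_bounded {α β : Type*} [MeasurableSpace α] {μ : Measure α}
    [IsFiniteMeasure μ] [NormedAddCommGroup β] {q : ENNReal} (hq : 1 ≤ q) (hq' : q ≠ ⊤)
    {f : ℕ → α → β} {g : α → β} {M M' : ℝ} (hf : ∀ k, AEStronglyMeasurable (f k) μ)
    (hM : ∀ k x, ‖f k x‖ ≤ M) (hg : AEStronglyMeasurable g μ) (hM' : ∀ x, ‖g x‖ ≤ M')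
    (h : ∀ᵐ x ∂μ, Tendsto (fun k => f k x) atTop (𝓝 (g x))) :
    Tendsto (fun k => eLpNorm (fun x => f k x - g x) q μ) atTop (𝓝 0) := by
  refine tendsto_Lp_finite_of_tendsto_ae hq hq' hf
    (MemLp.of_bound hg M' (Eventually.of_forall hM')) ?_ h
  refine unifIntegrable_of hq hq' hf fun ε _ => ⟨(|M| + 1).toNNReal, fun k => ?_⟩
  -- Above the uniform bound nothing is left to truncate, so uniform integrability is trivial and
  -- Vitali's convergence theorem applies.
  have hempty : {x | (|M| + 1).toNNReal ≤ ‖f k x‖₊} = ∅ := by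
    refine eq_empty_of_forall_notMem fun x hx => ?_
    have h1 : |M| + 1 ≤ ‖f k x‖ := Real.toNNReal_le_iff_le_coe.1 hx
    linarith [hM k x, le_abs_self M]
  rw [hempty]
  simp

theorem norm_gradient_le {u : Eucl n → ℝ} {K : NNReal} (hK : LipschitzWith K u) (x : Eucl n) :
    ‖gradient u x‖ ≤ K := by
  rw [gradient, LinearIsometryEquiv.norm_map]
  exact norm_fderiv_le_of_lipschitz ℝ hK

theorem measurable_gradient (u : Eucl n → ℝ) : Measurable (gradient u) :=
  (InnerProductSpace.toDual ℝ (Eucl n)).symm.continuous.measurable.comp (measurable_fderiv ℝ u)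

theorem inner_gradient (u : Eucl n → ℝ) (x v : Eucl n) :
    inner ℝ (gradient u x) v = fderiv ℝ u x v :=
  InnerProductSpace.toDual_symm_apply

theorem gradient_eq_zero_of_notMem_tsupport {u : Eucl n → ℝ} {x : Eucl n} (hx : x ∉ tsupport u) :
    gradient u x = 0 := by
  rw [gradient, fderiv_eq_zero_of_notMem_tsupport hx, map_zero]

theorem IsPerturbation.integral_fderiv_mul {u φ : Eucl n → ℝ} (hu : IsPerturbation u)
    (hφ : ContDiff ℝ 1 φ) (hφc : HasCompactSupport φ) (v : Eucl n) :
    ∫ x, fderiv ℝ u x v * φ x = -∫ x, fderiv ℝ φ x v * u x := by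
  obtain ⟨K, hK⟩ := hu.lipschitz
  obtain ⟨K', hK'⟩ := hφ.lipschitzWith_of_hasCompactSupport hφc one_ne_zero
  have h := LipschitzWith.integral_lineDeriv_mul_eq (μ := volume) hK hK' hφc v
  rw [← integral_neg]
  calc _ = ∫ x, lineDeriv ℝ u x v * φ x := by
        refine integral_congr_ae ?_
        filter_upwards [hu.affine] with x hx
        rw [hx.differentiableAt.lineDeriv_eq_fderiv]
    _ = _ := h
    _ = _ := by
        congr 1
        ext x
        rw [((hφ.differentiable one_ne_zero) x).lineDeriv_eq_fderiv, map_neg, neg_mul]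

theorem IsPerturbation.hasWeakGradient {u : Eucl n → ℝ} (hu : IsPerturbation u)
    {Ω : Set (Eucl n)} (hs : tsupport u ⊆ Ω) : HasWeakGradient Ω u (gradient u) := by
  rintro φ ⟨hφ, hφc, hφs⟩
  obtain ⟨K, hK⟩ := hu.lipschitz
  have hφ1 : ContDiff ℝ 1 φ := hφ.of_le (by simp)
  have hgφ : Continuous (gradient φ) :=
    (InnerProductSpace.toDual ℝ (Eucl n)).symm.continuous.comp (hφ1.continuous_fderiv one_ne_zero)
  rw [setIntegral_eq_integral_of_forall_compl_eq_zero fun x hx => by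
      rw [image_eq_zero_of_notMem_tsupport fun h => hx (hs h), zero_smul],
    setIntegral_eq_integral_of_forall_compl_eq_zero fun x hx => by
      rw [image_eq_zero_of_notMem_tsupport fun h => hx (hφs h), zero_smul]]
  have hi1 : Integrable fun x => u x • gradient φ x :=
    (hK.continuous.smul hgφ).integrable_of_hasCompactSupport hu.compact.smul_right
  have hi2 : Integrable fun x => φ x • gradient u x := by
    refine (hφ.continuous.integrable_of_hasCompactSupport hφc).smul_bdd K
      (measurable_gradient u).aestronglyMeasurable (Eventually.of_forall (norm_gradient_le hK))
  refine ext_inner_left ℝ fun v => ?_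
  rw [← integral_inner hi1, inner_neg_right, ← integral_inner hi2]
  have h := hu.integral_fderiv_mul hφ1 hφc v
  calc _ = ∫ x, fderiv ℝ φ x v * u x := by
        congr 1; ext x
        rw [inner_smul_right, real_inner_comm, inner_gradient, mul_comm]
    _ = -∫ x, fderiv ℝ u x v * φ x := by rw [h, neg_neg]
    _ = _ := by
        congr 2; ext x
        rw [inner_smul_right, real_inner_comm, inner_gradient, mul_comm]

/-- The mollifications are test functions with a common Lipschitz constant, and they converge with
their gradients almost everywhere; on a bounded domain this forces convergence in every finite
exponent. -/
theorem IsPerturbation.memSobolevZero {u : Eucl n → ℝ} (hu : IsPerturbation u)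
    {Ω : Set (Eucl n)} (hΩ : IsOpen Ω) (hb : Bornology.IsBounded Ω) (hs : tsupport u ⊆ Ω) {s : ℝ}
    (h1 : 1 ≤ s) : MemSobolevZero Ω s u (gradient u) := by
  obtain ⟨K, hK⟩ := hu.lipschitz
  obtain ⟨M, hM⟩ := hu.compact.exists_bound_of_continuous hK.continuous
  have : IsFiniteMeasure (volume.restrict Ω) := ⟨by simpa using hb.measure_lt_top⟩
  obtain ⟨φ, hφ, hφK, ⟨M', hM'⟩, hlim, hgrad⟩ := hu.exists_testFunction hK hΩ hs
  have hq : 1 ≤ ENNReal.ofReal s := by simpa using ENNReal.ofReal_le_ofReal h1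
  have hmu : AEStronglyMeasurable u (volume.restrict Ω) := hK.continuous.aestronglyMeasurable
  have hmg : ∀ f : Eucl n → ℝ, AEStronglyMeasurable (gradient f) (volume.restrict Ω) := fun f =>
    (measurable_gradient f).aestronglyMeasurable
  refine ⟨⟨MemLp.of_bound hmu M (Eventually.of_forall hM),
    MemLp.of_bound (hmg u) K (Eventually.of_forall (norm_gradient_le hK)),
    hu.hasWeakGradient hs⟩, φ, hφ, ?_, ?_⟩
  · exact tendsto_eLpNorm_sub_of_bounded hq ENNReal.ofReal_ne_top
      (fun k => (hφ k).1.continuous.aestronglyMeasurable) hM' hmu hM (Eventually.of_forall hlim)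
  · refine tendsto_eLpNorm_sub_of_bounded hq ENNReal.ofReal_ne_top (fun k => hmg (φ k))
      (fun k => norm_gradient_le (hφK k)) (hmg u) (norm_gradient_le hK) ?_
    filter_upwards [ae_restrict_of_ae hu.affine] with x hx
    exact tendsto_const_nhds.congr' ((hgrad x hx).mono fun k hk => hk.symm)

/-- The pieces are the level sets of the pair (slope, intercept). This pair is locally constant on
the open set of locally affine points, so the level sets are open, and by separability only
countably many are nonempty. -/
theorem IsPerturbation.isPiecewiseAffineLipschitz {u : Eucl n → ℝ} (hu : IsPerturbation u)
    {Ω : Set (Eucl n)} (hΩ : IsOpen Ω) : IsPiecewiseAffineLipschitz Ω u := by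
  obtain ⟨K, hK⟩ := hu.lipschitz
  refine ⟨⟨K, hK.lipschitzOnWith⟩, ?_⟩
  set germ : Eucl n → Eucl n × ℝ :=
    fun x => (gradient u x, u x - inner ℝ (gradient u x) x) with hgerm
  set O := {x | LocallyAffineAt u x} ∩ Ω with hO
  have hOopen : IsOpen O := (isOpen_setOf_locallyAffineAt u).inter hΩ
  have hconst : ∀ x ∈ O, ∀ᶠ y in 𝓝 x, germ y = germ x := by
    rintro x ⟨hx, -⟩
    filter_upwards [hx.eventually_eq.eventually_nhds] with y hy
    have hy0 := hy.self_of_nhds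
    have hgy : gradient u y = gradient u x := by
      rw [gradient, gradient]
      congr 1
      refine (LocallyAffineAt.hasFDerivAt ?_).fderiv
      filter_upwards [hy] with z hz
      rw [hz, hy0, map_sub, map_sub, map_sub]; ring
    simp only [hgerm]
    rw [hgy, inner_gradient, inner_gradient, hy0, map_sub]
    ring_nf
  have hopen : ∀ T : Set (Eucl n × ℝ), IsOpen {x | x ∈ O ∧ germ x ∈ T} := by
    intro T
    rw [isOpen_iff_mem_nhds]
    rintro x ⟨hx, hT⟩
    filter_upwards [hOopen.mem_nhds hx, hconst x hx] with y hy hy'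
    exact ⟨hy, hy' ▸ hT⟩
  have hcount : (germ '' O).Countable := by
    refine Set.PairwiseDisjoint.countable_of_isOpen 
      (s := fun c => {x | x ∈ O ∧ germ x ∈ ({c} : Set _)}) ?_ (fun c _ => hopen {c}) ?_
    · rintro c - d - hcd
      refine Set.disjoint_left.2 ?_
      rintro x ⟨-, h1⟩ ⟨-, h2⟩
      exact hcd ((mem_singleton_iff.1 h1).symm.trans (mem_singleton_iff.1 h2))
    · rintro c ⟨x, hx, rfl⟩
      exact ⟨x, hx, rfl⟩
  obtain ⟨code, hcode⟩ := Set.countable_iff_exists_injOn.1 hcount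
  refine ⟨fun m => {x | x ∈ O ∧ germ x ∈ code ⁻¹' {m}}, fun m => hopen _, fun m x hx => hx.1.2,
    ?_, ?_, ?_⟩
  · intro m k hmk
    refine Set.disjoint_left.2 ?_
    rintro x ⟨-, h1⟩ ⟨-, h2⟩
    exact hmk (h1.symm.trans h2)
  · refine measure_mono_null (fun x hx => ?_) (ae_iff.1 hu.affine)
    intro hx'
    exact hx.2 (mem_iUnion.2 ⟨code (germ x), ⟨hx', hx.1⟩, rfl⟩)
  · intro m
    by_cases hne : ∃ x, x ∈ O ∧ code (germ x) = m
    · obtain ⟨x, hx, hxm⟩ := hne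
      refine ⟨(germ x).1, (germ x).2, ?_⟩
      rintro y ⟨hy, hym⟩
      have : germ y = germ x :=
        hcode (mem_image_of_mem _ hy) (mem_image_of_mem _ hx) (Eq.trans hym hxm.symm)
      rw [← this]
      simp [hgerm]
    · refine ⟨0, 0, ?_⟩
      rintro y ⟨hy, hym⟩
      exact absurd ⟨y, hy, hym⟩ hne

end Sobolev

/-! ### The equation for the flux defect, and the counterexamples. -/

section PLaplace

theorem norm_perp (η : Eucl 2) : ‖perp η‖ = ‖η‖ := by
  rw [EuclideanSpace.norm_eq, EuclideanSpace.norm_eq, Fin.sum_univ_two, Fin.sum_univ_two]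
  simp [perp, add_comm]

theorem inner_perp (η ζ : Eucl 2) : inner ℝ (perp η) ζ = η 0 * ζ 1 - η 1 * ζ 0 := by
  rw [PiLp.inner_apply, Fin.sum_univ_two]
  simp [perp]; ring

theorem gradient_apply {n : ℕ} (u : Eucl n → ℝ) (x : Eucl n) (i : Fin n) :
    gradient u x i = fderiv ℝ u x (EuclideanSpace.single i 1) := by
  rw [← inner_gradient, EuclideanSpace.inner_single_right]
  simp

/-- The rotated gradient of a compactly supported function is divergence free. -/
theorem IsPerturbation.integral_inner_perp_gradient {v φ : Eucl 2 → ℝ} (hv : IsPerturbation v)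
    (hφ : ContDiff ℝ ∞ φ) (hφc : HasCompactSupport φ) :
    ∫ x, inner ℝ (perp (gradient v x)) (gradient φ x) = 0 := by
  set e : Fin 2 → Eucl 2 := fun i => EuclideanSpace.single i 1 with he
  have hd : ∀ i, ContDiff ℝ 1 fun x => fderiv ℝ φ x (e i) := fun i =>
    (hφ.fderiv_right (m := 1) (by norm_cast)).clm_apply contDiff_const
  have hc : ∀ i, HasCompactSupport fun x => fderiv ℝ φ x (e i) := fun i => hφc.fderiv_apply ℝ (e i)
  have hsecond : ∀ x i j, fderiv ℝ (fun x => fderiv ℝ φ x (e i)) x (e j) =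
      fderiv ℝ (fderiv ℝ φ) x (e j) (e i) := by
    intro x i j
    have h1 : DifferentiableAt ℝ (fderiv ℝ φ) x :=
      (hφ.fderiv_right (m := 1) (by norm_cast)).differentiable one_ne_zero x
    rw [fderiv_clm_apply h1 (differentiableAt_const _)]
    simp
  obtain ⟨K, hK⟩ := hv.lipschitz
  have hint : ∀ i j, Integrable fun x => fderiv ℝ v x (e i) * fderiv ℝ φ x (e j) := by
    intro i j
    refine ((hd j).continuous.integrable_of_hasCompactSupport (hc j)).bdd_mul (c := K * ‖e i‖)
      (measurable_fderiv_apply_const ℝ v (e i)).aestronglyMeasurable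
      (Eventually.of_forall fun x => ?_)
    exact (fderiv ℝ v x).le_of_opNorm_le (norm_fderiv_le_of_lipschitz ℝ hK) _
  simp only [inner_perp, gradient_apply]
  rw [integral_sub (hint 0 1) (hint 1 0), hv.integral_fderiv_mul (hd 1) (hc 1),
    hv.integral_fderiv_mul (hd 0) (hc 0), sub_eq_zero, neg_inj]
  -- Both integrals are now those of `v` against a mixed second derivative of `φ`, in the two
  -- orders.
  congr 1
  ext x
  rw [hsecond, hsecond]
  have hsymm : IsSymmSndFDerivAt ℝ φ x := hφ.contDiffAt.isSymmSndFDerivAt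
    (by rw [minSmoothness_of_isRCLikeNormedField]; norm_cast)
  rw [hsymm]

theorem measurable_fluxDefect {p : ℝ} (hp : 1 < p) (u v : Eucl 2 → ℝ) :
    Measurable (fluxDefect p u v) :=
  ((continuous_pFlux hp).measurable.comp (measurable_gradient u)).sub
    (continuous_perp.measurable.comp (measurable_gradient v))

theorem norm_pFlux_gradient_le {n : ℕ} {p : ℝ} (hp : 1 < p) {u : Eucl n → ℝ} {K : NNReal}
    (hu : LipschitzWith K u) (x : Eucl n) : ‖pFlux p (gradient u x)‖ ≤ K ^ (p - 1) := by
  rw [norm_pFlux hp]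
  exact Real.rpow_le_rpow (norm_nonneg _) (norm_gradient_le hu x) (by linarith)

theorem norm_fluxDefect_le {p : ℝ} (hp : 1 < p) {u v : Eucl 2 → ℝ} {K K' : NNReal}
    (hu : LipschitzWith K u) (hv : LipschitzWith K' v) (x : Eucl 2) :
    ‖fluxDefect p u v x‖ ≤ K ^ (p - 1) + K' := by
  refine (norm_sub_le _ _).trans (add_le_add (norm_pFlux_gradient_le hp hu x) ?_)
  exact (norm_perp (gradient v x)).trans_le (norm_gradient_le hv x)

/-- The flux and the defect differ by `∇^⊥v`, which is orthogonal to all gradients of test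
functions. -/
theorem solvesPLaplace_fluxDefect {p : ℝ} (hp : 1 < p) {u v : Eucl 2 → ℝ} {K : NNReal}
    (hu : LipschitzWith K u) (hv : IsPerturbation v) (Ω : Set (Eucl 2)) :
    SolvesPLaplace Ω p (gradient u) (fluxDefect p u v) := by
  rintro φ ⟨hφ, hφc, hφs⟩
  obtain ⟨K', hK'⟩ := hv.lipschitz
  have hφ1 : ContDiff ℝ 1 φ := hφ.of_le (by simp)
  have hgφ : Continuous (gradient φ) :=
    (InnerProductSpace.toDual ℝ (Eucl 2)).symm.continuous.comp (hφ1.continuous_fderiv one_ne_zero)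
  have hgi : Integrable (gradient φ) := hgφ.integrable_of_hasCompactSupport
    ((hφc.fderiv ℝ).comp_left (g := (InnerProductSpace.toDual ℝ (Eucl 2)).symm) (map_zero _))
  have hint : ∀ (f : Eucl 2 → Eucl 2) (C : ℝ), Measurable f → (∀ x, ‖f x‖ ≤ C) →
      Integrable fun x => inner ℝ (f x) (gradient φ x) := by
    intro f C hf hC
    refine (hgi.norm.const_mul C).mono' (hf.inner hgφ.measurable).aestronglyMeasurable
      (Eventually.of_forall fun x => (norm_inner_le_norm _ _).trans ?_)
    gcongr
    exact hC x
  have h1 := hint _ _ ((continuous_pFlux hp).measurable.comp (measurable_gradient u))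
    (norm_pFlux_gradient_le hp hu)
  have h2 := hint _ K' (continuous_perp.measurable.comp (measurable_gradient v))
    fun x => (norm_perp (gradient v x)).trans_le (norm_gradient_le hK' x)
  have hout : ∀ f : Eucl 2 → Eucl 2, ∫ x in Ω, inner ℝ (f x) (gradient φ x) =
      ∫ x, inner ℝ (f x) (gradient φ x) := fun f =>
    setIntegral_eq_integral_of_forall_compl_eq_zero fun x hx => by
      rw [gradient_eq_zero_of_notMem_tsupport fun h => hx (hφs h), inner_zero_right]
  rw [hout fun x => pFlux p (gradient u x), hout]
  have h3 : ∀ x, inner ℝ (fluxDefect p u v x) (gradient φ x) =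
      inner ℝ (pFlux p (gradient u x)) (gradient φ x) -
        inner ℝ (perp (gradient v x)) (gradient φ x) := fun x => inner_sub_left _ _ _
  simp only [h3]
  have h4 := integral_sub h1 h2
  simp only [Function.comp_apply] at h4
  rw [h4, hv.integral_inner_perp_gradient hφ hφc, sub_zero]

/-- Below the threshold exponent there are piecewise affine functions for which the `p`-Laplace
flux is arbitrarily close to a rotated gradient, relative to the size of the gradient. -/
theorem exists_piecewiseAffine_small_fluxDefect {p r Λ : ℝ} (hp : 1 < p) (hr : 1 < r)
    (hlt : r < thresholdExponent p) :
    ∃ u v : Eucl 2 → ℝ,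
      IsPiecewiseAffineLipschitz (unitBall 2) u ∧
      IsPiecewiseAffineLipschitz (unitBall 2) v ∧
      MemSobolevZero (unitBall 2) p u (gradient u) ∧
      MemSobolevZero (unitBall 2) p v (gradient v) ∧
      MemSobolevZero (unitBall 2) r u (gradient u) ∧
      MemLp (fluxDefect p u v) (ENNReal.ofReal (r / (p - 1)))
        (volume.restrict (unitBall 2)) ∧
      MemLp (fluxDefect p u v) (ENNReal.ofReal (p / (p - 1)))
        (volume.restrict (unitBall 2)) ∧
      SolvesPLaplace (unitBall 2) p (gradient u) (fluxDefect p u v) ∧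
      ∫ x in unitBall 2, ‖gradient u x‖ ^ r >
        Λ * ∫ x in unitBall 2, ‖fluxDefect p u v x‖ ^ (r / (p - 1)) := by
  have hs : 0 < r / (p - 1) := div_pos (by linarith) (by linarith)
  have hΩ : IsOpen (unitBall 2) := Metric.isOpen_ball
  have hb : Bornology.IsBounded (unitBall 2) := Metric.isBounded_ball
  have hfin : IsFiniteMeasure (volume.restrict (unitBall 2)) := ⟨by simpa using hb.measure_lt_top⟩
  obtain ⟨w, hw, hws, hexc⟩ := (relaxes_defectEnergy (Λ := Λ) hp (by linarith) hlt).exists_on_open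
    (continuous_defectEnergy hp (by linarith) hs.le) hΩ hb ⟨0, by simp [unitBall]⟩
  set u : Eucl 2 → ℝ := fun x => ContinuousLinearMap.fst ℝ ℝ ℝ (w x) with hudef
  set v : Eucl 2 → ℝ := fun x => ContinuousLinearMap.snd ℝ ℝ ℝ (w x) with hvdef
  have hu : IsPerturbation u := hw.clm_comp _
  have hv : IsPerturbation v := hw.clm_comp _
  have hus : tsupport u ⊆ unitBall 2 :=
    (tsupport_comp_subset (map_zero (ContinuousLinearMap.fst ℝ ℝ ℝ)) w).trans hws
  have hvs : tsupport v ⊆ unitBall 2 :=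
    (tsupport_comp_subset (map_zero (ContinuousLinearMap.snd ℝ ℝ ℝ)) w).trans hws
  obtain ⟨K, hK⟩ := hu.lipschitz
  obtain ⟨K', hK'⟩ := hv.lipschitz
  have hmem : ∀ q, MemLp (fluxDefect p u v) q (volume.restrict (unitBall 2)) := fun q =>
    MemLp.of_bound (measurable_fluxDefect hp u v).aestronglyMeasurable _
      (Eventually.of_forall (norm_fluxDefect_le hp hK hK'))
  refine ⟨u, v, hu.isPiecewiseAffineLipschitz hΩ, hv.isPiecewiseAffineLipschitz hΩ,
    hu.memSobolevZero hΩ hb hus hp.le, hv.memSobolevZero hΩ hb hvs hp.le,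
    hu.memSobolevZero hΩ hb hus hr.le, hmem _, hmem _,
    solvesPLaplace_fluxDefect hp hK hv _, ?_⟩
  have hF0 : defectEnergy p r (r / (p - 1)) Λ 0 = 0 := by
    simp [defectEnergy, gradForm, pFlux, perp, Real.zero_rpow hs.ne',
      Real.zero_rpow (by linarith : r ≠ 0), EuclideanSpace.norm_eq]
  have hexc' : excess (defectEnergy p r (r / (p - 1)) Λ) 0 w =
      ∫ x in unitBall 2, (Λ * ‖fluxDefect p u v x‖ ^ (r / (p - 1)) - ‖gradient u x‖ ^ r) := by
    have hzero : ∀ x ∉ unitBall 2,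
        Λ * ‖fluxDefect p u v x‖ ^ (r / (p - 1)) - ‖gradient u x‖ ^ r = 0 := by
      intro x hx
      have hgu : gradient u x = 0 := gradient_eq_zero_of_notMem_tsupport fun h => hx (hus h)
      have hgv : gradient v x = 0 := gradient_eq_zero_of_notMem_tsupport fun h => hx (hvs h)
      have hd : fluxDefect p u v x = 0 := by
        rw [← norm_eq_zero]
        simp [fluxDefect, perpGradient, hgu, hgv, pFlux, EuclideanSpace.norm_eq]
      rw [hd, hgu, norm_zero, Real.zero_rpow hs.ne', Real.zero_rpow (by linarith)]
      ring
    rw [setIntegral_eq_integral_of_forall_compl_eq_zero hzero, excess]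
    refine integral_congr_ae ?_
    filter_upwards [hw.affine] with x hx
    have hux : fderiv ℝ u x = (ContinuousLinearMap.fst ℝ ℝ ℝ).comp (fderiv ℝ w x) :=
      ((ContinuousLinearMap.fst ℝ ℝ ℝ).hasFDerivAt.comp x hx.differentiableAt.hasFDerivAt).fderiv
    have hvx : fderiv ℝ v x = (ContinuousLinearMap.snd ℝ ℝ ℝ).comp (fderiv ℝ w x) :=
      ((ContinuousLinearMap.snd ℝ ℝ ℝ).hasFDerivAt.comp x hx.differentiableAt.hasFDerivAt).fderiv
    rw [hF0, sub_zero, zero_add, defectEnergy, ← hux, ← hvx]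
    rfl
  -- Relaxation from the zero state to level `0` says precisely that the integral of the defect
  -- energy over the disc is negative.
  rw [hF0, sub_zero, zero_mul, hexc'] at hexc
  have hi1 : Integrable (fun x => Λ * ‖fluxDefect p u v x‖ ^ (r / (p - 1)))
      (volume.restrict (unitBall 2)) := by
    refine Integrable.const_mul (Integrable.of_bound
      ((measurable_fluxDefect hp u v).norm.pow_const _).aestronglyMeasurable
      ((K ^ (p - 1) + K') ^ (r / (p - 1)) : ℝ) (Eventually.of_forall fun x => ?_)) Λ
    rw [Real.norm_of_nonneg (Real.rpow_nonneg (norm_nonneg _) _)]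
    exact Real.rpow_le_rpow (norm_nonneg _) (norm_fluxDefect_le hp hK hK' x) hs.le
  have hi2 : Integrable (fun x => ‖gradient u x‖ ^ r) (volume.restrict (unitBall 2)) := by
    refine Integrable.of_bound
      ((measurable_gradient u).norm.pow_const _).aestronglyMeasurable
      ((K : ℝ) ^ r) (Eventually.of_forall fun x => ?_)
    rw [Real.norm_of_nonneg (Real.rpow_nonneg (norm_nonneg _) _)]
    exact Real.rpow_le_rpow (norm_nonneg _) (norm_gradient_le hK x) (by linarith)
  rw [integral_sub hi1 hi2, integral_const_mul] at hexc
  linarith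

theorem not_iwaniecEstimate {p r : ℝ} (hp : 1 < p) (hr : 1 < r) (hlt : r < thresholdExponent p) :
    ¬ IwaniecEstimate 2 p r := by
  rintro ⟨C, hC⟩
  obtain ⟨u, v, -, -, hup, -, hur, hf, hf', hsol, hgt⟩ :=
    exists_piecewiseAffine_small_fluxDefect (Λ := C) hp hr hlt
  exact (hC u (gradient u) (fluxDefect p u v) hur hup hf hf' hsol).not_gt hgt

end PLaplace

theorem theorem1p3 (p : ℝ) (hp : 1 < p) (hp2 : p ≠ 2) :
    max (p - 1) 1 < thresholdExponent p ∧
    (∀ q : ℝ, max (p - 1) 1 < q → q < thresholdExponent p →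
      ∀ Λ : ℝ, 0 < Λ → ∀ r : ℝ, max (p - 1) 1 < r → r < q →
        ∃ u v : Eucl 2 → ℝ,
          IsPiecewiseAffineLipschitz (unitBall 2) u ∧
          IsPiecewiseAffineLipschitz (unitBall 2) v ∧
          MemSobolevZero (unitBall 2) p u (gradient u) ∧
          MemSobolevZero (unitBall 2) p v (gradient v) ∧
          MemSobolevZero (unitBall 2) r u (gradient u) ∧
          MemLp (fluxDefect p u v) (ENNReal.ofReal (r / (p - 1)))
            (volume.restrict (unitBall 2)) ∧
          MemLp (fluxDefect p u v) (ENNReal.ofReal (p / (p - 1)))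
            (volume.restrict (unitBall 2)) ∧
          SolvesPLaplace (unitBall 2) p (gradient u) (fluxDefect p u v) ∧
          ∫ x in unitBall 2, ‖gradient u x‖ ^ r >
            Λ * ∫ x in unitBall 2, ‖fluxDefect p u v x‖ ^ (r / (p - 1))) ∧
    (∀ r : ℝ, max (p - 1) 1 < r → r < thresholdExponent p → ¬ IwaniecEstimate 2 p r) ∧
    ¬ IwaniecConjecture := by

  have hmax := max_lt_thresholdExponent hp hp2
  refine ⟨hmax, fun q _ hq Λ _ r hr hrq => ?_, fun r hr hlt => ?_, fun h => ?_⟩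
  · exact exists_piecewiseAffine_small_fluxDefect hp ((le_max_right _ _).trans_lt hr)
      (hrq.trans hq)
  · exact not_iwaniecEstimate hp ((le_max_right _ _).trans_lt hr) hlt
  · obtain ⟨r, hr, hlt⟩ := exists_between hmax
    exact not_iwaniecEstimate hp ((le_max_right _ _).trans_lt hr) hlt (h 2 p r le_rfl hp hr)
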